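/- All graphs are finite, simple and non-empty. For a graph $G$, $I(G)$ denotes (the geometric realization of) its independence complex, whose faces are the independent sets of $G$; an induced matching $M$ in $G$ is a set of edges forming an induced subgraph of $G$, $|M|$ is the number of its edges and $V(M)$ the set of their endpoints; a dominating transversal of $M$ is a set $\sigma\subseteq V(M)$ containing exactly one vertex from each edge of $M$, such that every vertex of $G$ lies in $\sigma$ or has a neighbour in $\sigma$. The wedge of an empty family is a point. **(1)** Let $k\ge 0$ and let $(M_i,\sigma_i)$, $i=1,\dots,k$, be a sequence of induced matchings with dominating transversals in a graph $G$, such that $\sigma_j\setminus V(M_i)\neq\emptyset$ for all $i<j$. Then $|M_i|\ge 1$ and $I(M_i)$ is homeomorphic to the sphere $S^{|M_i|-1}$ for every $i$. Suppose moreover that those $I(M_i)\subseteq I(G)$ with $|M_i|\ge 2$ all lie in one path component of $I(G)$ (which holds, for instance, if $I(G)$ is connected or if $k\le 1$). Then there is a pointed space $X$ with homotopy equivalences $$I(G)\simeq\Big(\bigvee_{i=1}^k I(M_i)\Big)\vee X\simeq\Big(\bigvee_{i=1}^k S^{|M_i|-1}\Big)\vee X,$$ for any choice of base points in the $I(M_i)$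 and in the spheres. **(2)** The Kagome lattice is the graph whose vertices are the points $a(1,0)+b(\tfrac12,\tfrac{\sqrt3}2)$ with $a,b\in\mathbb Z$ not both odd, two of them being adjacent if their distance is $1$. The points with $a,b$ both odd are its holes, and the six vertices at distance $1$ from a hole form a hexagon. The large hexagon centred at a hole $c$ consists of the $30$ vertices of the hexagon around $c$ and of the six hexagons around the holes at distance $2$ from $c$. The large hexagons centred at the points of $c+T$, where $T=\mathbb Z(6,2\sqrt3)+\mathbb Z(6,-2\sqrt3)$, form a tiling of the lattice. Let $\mathbb H$ be a finite quotient of the Kagome lattice by a group of translations that preserves such a tiling for some hole $c$. Then its number of vertices is $v(\mathbb H)=36t$ for an integer $t\ge 1$, and $$I(\mathbb H)\simeq\Big(\bigvee^{2^{v(\mathbb H)/36}} S^{2v(\mathbb H)/9-1}\Big)\vee X$$ for some pointed space $X$ (and any base points in the spheres). **(3)** If $n,m\ge 1$, $6\mid n$ and $4\mid m$, then the quotient $\mathbb H_{n,m}$ of the Kagome lattice by the translations generated by $n\cdot(2,0)$ and $m\cdot(0,\sqrt3)$ is a quotient as in (2), and it has $3nm$ vertices. -/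

import Mathlib

open scoped ContinuousMap

universe u v

/-! ### Wedge sums of pointed spaces -/

/-- The gluing relation of `IndexedWedge`: each base point `y i` is identified with one common
point. -/
inductive IndexedWedge.Rel {ι : Type u} {Y : ι → Type v} (y : ∀ i, Y i) :
    Unit ⊕ (Σ i, Y i) → Unit ⊕ (Σ i, Y i) → Prop
  | glue (i : ι) : IndexedWedge.Rel y (Sum.inl ()) (Sum.inr ⟨i, y i⟩)

/-- The wedge `⋁ i, Y i` of the pointed spaces `(Y i, y i)`, with the quotient topology. The extra
point `Unit` becomes the common base point; it only makes the empty wedge equal to a point. -/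
def IndexedWedge {ι : Type u} (Y : ι → Type v) (y : ∀ i, Y i) : Type (max u v) :=
  Quot (IndexedWedge.Rel y)

instance IndexedWedge.instTopologicalSpace {ι : Type u} (Y : ι → Type v)
    [∀ i, TopologicalSpace (Y i)] (y : ∀ i, Y i) : TopologicalSpace (IndexedWedge Y y) :=
  inferInstanceAs (TopologicalSpace (Quot (IndexedWedge.Rel y)))

/-- The base point of `⋁ i, Y i`. -/
def IndexedWedge.base {ι : Type u} (Y : ι → Type v) (y : ∀ i, Y i) : IndexedWedge Y y :=
  Quot.mk _ (Sum.inl ())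

/-- The gluing relation of `Wedge`. -/
inductive Wedge.Rel {A : Type u} {B : Type v} (a : A) (b : B) : A ⊕ B → A ⊕ B → Prop
  | glue : Wedge.Rel a b (Sum.inl a) (Sum.inr b)

/-- The wedge `A ∨ B` of two pointed spaces `(A, a)` and `(B, b)`, with the quotient topology. -/
def Wedge {A : Type u} {B : Type v} (a : A) (b : B) : Type (max u v) :=
  Quot (Wedge.Rel a b)

instance Wedge.instTopologicalSpace {A : Type u} {B : Type v} [TopologicalSpace A]
    [TopologicalSpace B] (a : A) (b : B) : TopologicalSpace (Wedge a b) :=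
  inferInstanceAs (TopologicalSpace (Quot (Wedge.Rel a b)))

/-- The unit sphere of `ℝ^d`; this is the sphere `S^(d-1)` of dimension `d - 1`. -/
abbrev UnitSphere (d : ℕ) : Set (EuclideanSpace ℝ (Fin d)) :=
  Metric.sphere (0 : EuclideanSpace ℝ (Fin d)) 1

/-! ### Independence complexes -/

/-- The geometric realization of an abstract simplicial complex on a finite vertex set: points are
given by barycentric coordinates supported on a face, topologized as a subspace of `V → ℝ`. -/
def AbstractSimplicialComplex.realization {V : Type u} [Finite V]
    (K : AbstractSimplicialComplex V) : Set (V → ℝ) :=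
  {x | (∀ v, 0 ≤ x v) ∧ ∃ s ∈ K.faces, (∀ v, v ∉ s → x v = 0) ∧ ∑ v ∈ s, x v = 1}

namespace SimpleGraph

/-- The independence complex of `G`: the (nonempty) faces are the nonempty finite independent
sets of `G`. -/
def indepComplex {V : Type u} (G : SimpleGraph V) : AbstractSimplicialComplex V where
  faces := {s | s.Nonempty ∧ G.IsIndepSet (s : Set V)}
  isRelLowerSet_faces := fun _ hs =>
    ⟨hs.1, fun _ hts ht => ⟨ht, hs.2.mono (Finset.coe_subset.mpr hts)⟩⟩
  singleton_mem := fun v => ⟨Finset.singleton_nonempty v, by simp⟩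

/-- The space `I(G)`: the geometric realization of the independence complex of a finite graph. -/
abbrev indepSpace {V : Type u} [Finite V] (G : SimpleGraph V) : Set (V → ℝ) :=
  G.indepComplex.realization

/-- An induced matching in `G`: a matching that is an induced subgraph of `G`. -/
def Subgraph.IsInducedMatching {V : Type u} {G : SimpleGraph V} (M : G.Subgraph) : Prop :=
  M.IsMatching ∧ M.IsInduced

/-- `σ` is a dominating transversal of the matching `M` in `G`: it consists of exactly one vertex
from each edge of `M`, and every vertex of `G` lies in `σ` or is adjacent to a vertex of `σ`. -/
structure Subgraph.IsDominatingTransversal {V : Type u} {G : SimpleGraph V} (M : G.Subgraph)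
    (σ : Set V) : Prop where
  subset_verts : σ ⊆ M.verts
  existsUnique : ∀ e ∈ M.edgeSet, ∃! v, v ∈ σ ∧ v ∈ e
  dominating : ∀ v, v ∈ σ ∨ ∃ w ∈ σ, G.Adj v w

end SimpleGraph

/-! ### The Kagome lattice and its finite quotients -/

/-- The vertices of the Kagome lattice. The pair `(a, b)` stands for the point
`a • (1, 0) + b • (1/2, √3/2)` of the triangular lattice. Of the three families of lattice lines,
the lines `a = const` and `b = const` are kept if the constant is even, the lines `a + b = const`
if it is odd; a point lies on some kept line iff its coordinates are not both odd. -/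
abbrev KagomeVertex : Type := {p : ℤ × ℤ // ¬ (Odd p.1 ∧ Odd p.2)}

/-- The six unit vectors of the triangular lattice. -/
def triangularUnits : Set (ℤ × ℤ) :=
  {(1, 0), (-1, 0), (0, 1), (0, -1), (1, -1), (-1, 1)}

/-- The Kagome lattice. Two of its vertices at distance one always lie on a common kept line, so it
is an induced subgraph of the triangular lattice. -/
def kagomeLattice : SimpleGraph KagomeVertex where
  Adj p q := q.1 - p.1 ∈ triangularUnits
  symm := ⟨fun p q h => by
    simp only [triangularUnits, Set.mem_insert_iff, Set.mem_singleton_iff, Prod.ext_iff,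
      Prod.fst_sub, Prod.snd_sub] at h ⊢
    omega⟩
  loopless := ⟨fun p h => by
    simp [triangularUnits, Prod.ext_iff] at h⟩

/-- Two vertices of the Kagome lattice are identified when they differ by a translation in `L`. -/
def kagomeSetoid (L : AddSubgroup (ℤ × ℤ)) : Setoid KagomeVertex where
  r p q := q.1 - p.1 ∈ L
  iseqv :=
    { refl := fun p => by simp
      symm := fun {p q} h => by simpa using L.neg_mem h
      trans := fun {p q r} h h' => by simpa using L.add_mem h' h }

/-- The vertex set of the quotient of the Kagome lattice by a group `L` of translations. -/
abbrev KagomeQuotient (L : AddSubgroup (ℤ × ℤ)) : Type := Quotient (kagomeSetoid L)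

/-- The quotient of the Kagome lattice by a group `L` of translations: two distinct classes are
adjacent iff they have adjacent representatives. -/
def kagomeQuotientGraph (L : AddSubgroup (ℤ × ℤ)) : SimpleGraph (KagomeQuotient L) where
  Adj x y := x ≠ y ∧ ∃ p q : KagomeVertex,
    Quotient.mk (kagomeSetoid L) p = x ∧ Quotient.mk (kagomeSetoid L) q = y ∧
      kagomeLattice.Adj p q
  symm := ⟨fun _ _ h => by
    obtain ⟨hne, p, q, hp, hq, h⟩ := h
    exact ⟨hne.symm, q, p, hq, hp, h.symm⟩⟩
  loopless := ⟨fun _ h => h.1 rfl⟩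

/-- The centres of the large hexagons of a tiling, one of them being `c`.

The holes of the Kagome lattice are the points with both coordinates odd; the six vertices around
a hole form a hexagon. The large hexagon centred at the hole `c` has `30` vertices: those of the
hexagon around `c` and of the six hexagons around the neighbouring holes `c + 2 • d`, `d` a unit
vector. Large hexagons tile the lattice with the period group generated by `(4, 4)` and `(8, -4)`
(in Cartesian coordinates `(6, 2√3)` and `(6, -2√3)`): they are disjoint, there are no edges
between different ones, the uncovered vertices form an independent set, and there are `6` of them
per large hexagon. -/
def hexagonCentres (c : ℤ × ℤ) : Set (ℤ × ℤ) :=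
  {x | ∃ i j : ℤ, x = c + i • ((4, 4) : ℤ × ℤ) + j • ((8, -4) : ℤ × ℤ)}

/-- The quotient of the Kagome lattice by `L` is tiled by large hexagons: `L` consists of
translations that preserve the tiling of the lattice by large hexagons which has one centred at a
suitable hole `c`. -/
def IsTiledKagome (L : AddSubgroup (ℤ × ℤ)) : Prop :=
  ∃ c : ℤ × ℤ, Odd c.1 ∧ Odd c.2 ∧
    ∀ l ∈ L, ∀ x ∈ hexagonCentres c, x + l ∈ hexagonCentres c

/-- The translations generated by `n • (2, 0)` and `m • (0, √3)` (Cartesian coordinates). -/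
def kagomePeriods (n m : ℕ) : AddSubgroup (ℤ × ℤ) :=
  AddSubgroup.closure {(2 * (n : ℤ), 0), (-(m : ℤ), 2 * (m : ℤ))}

/-!
Splitting of independence complexes along induced matchings.

The independence complex of an induced matching with `d` edges is the boundary of a cross-polytope
of dimension `d` (`nonempty_crossPolytope_homeomorph_indepSpace`), which is a sphere by rescaling
(`crossPolytopeHomeomorph`). A dominating transversal spans a facet of this cross-polytope that is
a maximal face of `I(G)`. Let `indepRest` be `I(G)` without the open facets of all transversals,
so that `I(G)` arises from it by attaching these facets as cells
(`IsMatchingSequence.isCellAttachment`).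

The boundary of each facet also bounds the rest of its cross-polytope, a disc that contracts to
the centre of the opposite facet. This disc lies in `I(G)`, but it may contain open facets of
earlier matchings. It does not contain those of later ones, which is what the condition on the
sequence says. Hence folding every facet over to the opposite side of its own cross-polytope, from
the last facet to the first one, gives a retraction of `I(G)` to `indepRest`
(`IsMatchingSequence.exists_retraction`). The retraction carries the contractions of the discs to
null-homotopies of the attaching maps in `indepRest`, and it carries paths of `I(G)` to paths that
bring all these null-homotopies to a common base point (`IsMatchingSequence.exists_attaching`). A
matching with a single edge needs no path, as its facet is a point and has an empty boundary.

Attaching a cell along a null-homotopic map amounts to forming the wedge with a sphere. This is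
`IsCellAttachment.nonempty_homotopyEquiv_wedge`, which treats all cells at once: the sphere is the
same cell attached to a space that contracts to its base point, and the maps between the two sides
and the homotopies are radial dilations of the cells, continued beyond their boundaries by the
null-homotopies. Since spheres are homogeneous, the base points are arbitrary.

For the Kagome lattice, each large hexagon carries two induced matchings of eight edges with
transversals that differ only in the two edges at the central hexagon. Both dominate the hexagon,
and together the hexagons also dominate the vertices between them, whatever the choices
(`hexagonEdge_dominating`). There are no edges between the matchings in different hexagons
(`hexagonOffsets_not_adj`). So `t` hexagons give `2 ^ t` induced matchings with `8 * t` edges, and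
listing the choices by binary digits makes them a sequence of the required kind
(`isMatchingSequence_kagome`). The independence complex is path connected because each vertex has
at most six neighbours (`exists_not_adj_kagomeQuotient`). The number of vertices is found by
counting residues modulo the period lattice of the tiling (`card_kagomeQuotient`).
-/

/-! ### Maps out of wedges -/

section WedgeMaps

open unitInterval

variable {ι : Type*} {Y : ι → Type*} [∀ i, TopologicalSpace (Y i)] {p : ∀ i, Y i}
  {X : Type*} [TopologicalSpace X] {x₀ : X} {Z : Type*} [TopologicalSpace Z]

variable (p x₀) in
/-- The inclusion of the `i`-th summand into `(⋁ i, Y i) ∨ X`. -/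
def wedgeSummand (i : ι) : C(Y i, Wedge (IndexedWedge.base Y p) x₀) where
  toFun y := Quot.mk _ (Sum.inl (Quot.mk _ (Sum.inr ⟨i, y⟩)))
  continuous_toFun := continuous_quot_mk.comp (continuous_inl.comp
    (continuous_quot_mk.comp (continuous_inr.comp continuous_sigmaMk)))

variable (p x₀) in
/-- The inclusion of the last summand into `(⋁ i, Y i) ∨ X`. -/
def wedgeRest : C(X, Wedge (IndexedWedge.base Y p) x₀) where
  toFun x := Quot.mk _ (Sum.inr x)
  continuous_toFun := continuous_quot_mk.comp continuous_inr

theorem wedgeSummand_base (i : ι) : wedgeSummand p x₀ i (p i) = wedgeRest p x₀ x₀ := by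
  have h1 : (Quot.mk _ (Sum.inr ⟨i, p i⟩) : IndexedWedge Y p) = IndexedWedge.base Y p :=
    (Quot.sound (IndexedWedge.Rel.glue i)).symm
  exact (congrArg (fun a => Quot.mk _ (Sum.inl a)) h1).trans (Quot.sound Wedge.Rel.glue)

theorem wedge_cases {P : Wedge (IndexedWedge.base Y p) x₀ → Prop}
    (hY : ∀ i y, P (wedgeSummand p x₀ i y)) (hX : ∀ x, P (wedgeRest p x₀ x)) (w) : P w := by
  rcases w with ⟨w | x⟩
  · rcases w with ⟨⟨⟩ | ⟨i, y⟩⟩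
    · have : (Quot.mk _ (Sum.inl (IndexedWedge.base Y p)) : Wedge (IndexedWedge.base Y p) x₀) =
        wedgeRest p x₀ x₀ := Quot.sound Wedge.Rel.glue
      exact this ▸ hX x₀
    · exact hY i y
  · exact hX x

/-- The universal property of `(⋁ i, Y i) ∨ X`. -/
theorem exists_wedge_desc (f : ∀ i, C(Y i, Z)) (r : C(X, Z)) (h : ∀ i, f i (p i) = r x₀) :
    ∃ Φ : C(Wedge (IndexedWedge.base Y p) x₀, Z),
      (∀ i y, Φ (wedgeSummand p x₀ i y) = f i y) ∧ ∀ x, Φ (wedgeRest p x₀ x) = r x := by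
  let Ψ : IndexedWedge Y p → Z := Quot.lift (Sum.elim (fun _ => r x₀) (fun s => f s.1 s.2)) (by
    rintro _ _ ⟨i⟩
    exact (h i).symm)
  have hΨ : Continuous Ψ := continuous_quot_lift _
    (continuous_const.sumElim (continuous_sigma fun i => (f i).continuous))
  refine ⟨⟨Quot.lift (Sum.elim Ψ r) ?_, continuous_quot_lift _ (hΨ.sumElim r.continuous)⟩,
    fun _ _ => rfl, fun _ => rfl⟩
  rintro _ _ ⟨⟩
  rfl

/-- A homotopy given as a map to the path space. In this form homotopies are constructed by the
universal properties of quotients, without taking products of quotient maps. -/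
theorem homotopic_of_paths {A : Type*} [TopologicalSpace A] {f g : C(A, Z)} (Φ : C(A, C(I, Z)))
    (h0 : ∀ a, Φ a 0 = f a) (h1 : ∀ a, Φ a 1 = g a) : f.Homotopic g :=
  ⟨{ toContinuousMap := Φ.uncurry.comp ⟨Prod.swap, continuous_swap⟩
     map_zero_left := h0
     map_one_left := h1 }⟩

end WedgeMaps

/-! ### Attaching cells -/

section Attach

open unitInterval Topology

/-- A continuous and positively homogeneous function; its sublevel set `{g ≤ 1}` plays
the role of a closed ball and `{g = 1}` that of the bounding sphere. -/
structure IsGauge {E : Type*} [AddCommGroup E] [Module ℝ E] [TopologicalSpace E] (g : E → ℝ) :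
    Prop where
  continuous : Continuous g
  map_smul : ∀ (c : ℝ) (w : E), 0 ≤ c → g (c • w) = c * g w

/-- `K` arises from `L` by attaching the balls `{g i ≤ 1}` along the maps `ℓ i : {g i = 1} → L`;
`χ i` is the characteristic map of the `i`-th cell. Both `ℓ i` and `χ i` are defined on all of
`E i`, but `χ i` matters only on the ball. That `ℓ i` extends continuously from the sphere over the
ball encodes that the attaching map is null-homotopic. -/
structure IsCellAttachment {ι : Type*} {E : ι → Type*} [∀ i, TopologicalSpace (E i)]
    (g : ∀ i, E i → ℝ) {L K : Type*} [TopologicalSpace L] [TopologicalSpace K]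
    (j : C(L, K)) (ℓ : ∀ i, C(E i, L)) (χ : ∀ i, C(E i, K)) : Prop where
  isQuotientMap : IsQuotientMap
    (Sum.elim j (fun x : Σ i, {w : E i // g i w ≤ 1} => χ x.1 x.2))
  compat : ∀ i w, g i w = 1 → χ i w = j (ℓ i w)
  injective : Function.Injective j
  cell_eq_base : ∀ i w y, χ i w = j y → g i w ≤ 1 → g i w = 1
  cell_eq_cell : ∀ i w i' w', χ i w = χ i' w' → g i w ≤ 1 → g i' w' ≤ 1 →
    (⟨i, w⟩ : Σ i, E i) = ⟨i', w'⟩ ∨ g i w = 1 ∧ g i' w' = 1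

namespace IsCellAttachment

variable {ι : Type*} {E : ι → Type*} [∀ i, TopologicalSpace (E i)]
    {g : ∀ i, E i → ℝ} {L K : Type*} [TopologicalSpace L] [TopologicalSpace K]
    {j : C(L, K)} {ℓ : ∀ i, C(E i, L)} {χ : ∀ i, C(E i, K)}

theorem cases (h : IsCellAttachment g j ℓ χ) {P : K → Prop} (hj : ∀ y, P (j y))
    (hχ : ∀ i w, g i w ≤ 1 → P (χ i w)) (x : K) : P x := by
  obtain ⟨y | ⟨i, w, hw⟩, rfl⟩ := h.isQuotientMap.surjective x
  · exact hj y
  · exact hχ i w hw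

/-- The universal property of a space obtained by attaching cells. -/
theorem exists_desc (h : IsCellAttachment g j ℓ χ) {Z : Type*} [TopologicalSpace Z] (φ : C(L, Z))
    (ψ : ∀ i, C(E i, Z)) (hψ : ∀ i w, g i w = 1 → ψ i w = φ (ℓ i w)) :
    ∃ Φ : C(K, Z), (∀ y, Φ (j y) = φ y) ∧ ∀ i w, g i w ≤ 1 → Φ (χ i w) = ψ i w := by
  let f : C(L ⊕ (Σ i, {w : E i // g i w ≤ 1}), Z) :=
    ⟨Sum.elim φ (fun x => ψ x.1 x.2), φ.continuous.sumElim
      (continuous_sigma fun i => (ψ i).continuous.comp continuous_subtype_val)⟩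
  let q : C(L ⊕ (Σ i, {w : E i // g i w ≤ 1}), K) := ⟨_, h.isQuotientMap.continuous⟩
  have hq : IsQuotientMap q := h.isQuotientMap
  have key : Function.FactorsThrough f q := by
    have h1 : ∀ i w y, g i w ≤ 1 → χ i w = j y → ψ i w = φ y := by
      intro i w y hw e
      have hg := h.cell_eq_base i w y e hw
      rw [hψ i w hg, ← h.injective (e.symm.trans (h.compat i w hg))]
    rintro (y | ⟨i, w, hw⟩) (y' | ⟨i', w', hw'⟩) e
    · exact congrArg φ (h.injective e)
    · exact (h1 i' w' y hw' e.symm).symm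
    · exact h1 i w y' hw e
    · rcases h.cell_eq_cell i w i' w' e hw hw' with h2 | ⟨h2, h3⟩
      · exact congrArg (fun s : Σ i, E i => ψ s.1 s.2) h2
      · refine (h1 i w (ℓ i' w') hw ?_).trans (hψ i' w' h3).symm
        exact Eq.trans e (h.compat i' w' h3)
  refine ⟨hq.lift f key, fun y => ?_, fun i w hw => ?_⟩
  · exact DFunLike.congr_fun (hq.lift_comp f key) (Sum.inl y)
  · exact DFunLike.congr_fun (hq.lift_comp f key) (Sum.inr ⟨i, w, hw⟩)

/-- A characteristic map, continued beyond its ball by the extended attaching map. -/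
theorem exists_extension (h : IsCellAttachment g j ℓ χ) (hg : ∀ i, Continuous (g i)) (i : ι) :
    ∃ F : C(E i, K), (∀ w, g i w ≤ 1 → F w = χ i w) ∧ ∀ w, 1 ≤ g i w → F w = j (ℓ i w) := by
  classical
  refine ⟨⟨fun w => if g i w ≤ 1 then χ i w else j (ℓ i w), continuous_if_le (hg i)
    continuous_const (χ i).continuous.continuousOn
    (j.continuous.comp (ℓ i).continuous).continuousOn (h.compat i)⟩, fun w hw => ?_, fun w hw => ?_⟩
  · simp [hw]
  · rcases hw.eq_or_lt with e | e
    · simp [← e, h.compat i w e.symm]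
    · simp [e.not_ge]

end IsCellAttachment

/-- Transport of a cell attachment along a homeomorphism. -/
theorem IsCellAttachment.comp_homeomorph {ι : Type*} {E : ι → Type*} [∀ i, TopologicalSpace (E i)]
    {g : ∀ i, E i → ℝ} {L K : Type*} [TopologicalSpace L] [TopologicalSpace K]
    {j : C(L, K)} {ℓ : ∀ i, C(E i, L)} {χ : ∀ i, C(E i, K)} (h : IsCellAttachment g j ℓ χ)
    {K' : Type*} [TopologicalSpace K'] (e : K ≃ₜ K') :
    IsCellAttachment g ((e : C(K, K')).comp j) ℓ (fun i => (e : C(K, K')).comp (χ i)) where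
  isQuotientMap := by
    convert e.isQuotientMap.comp h.isQuotientMap using 1
    funext x
    rcases x with x | x <;> rfl
  compat i w hw := congrArg e (h.compat i w hw)
  injective := e.injective.comp h.injective
  cell_eq_base i w y hy := h.cell_eq_base i w y (e.injective hy)
  cell_eq_cell i w i' w' hy := h.cell_eq_cell i w i' w' (e.injective hy)

/-- Suppose that `K` arises from `L` by attaching cells whose attaching maps extend to maps `ℓ i :
E i → L` that are constant with value `x₀` outside a larger ball, and that `Y i` arises from `D i`
by attaching the same cell, where `D i` contracts to `p i` through `C i`, with `p i` fixed, and
the attaching map is continued radially by this contraction. Then `K ≃ (⋁ i, Y i) ∨ L`. -/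
theorem IsCellAttachment.nonempty_homotopyEquiv_wedge {ι : Type*} {E : ι → Type*}
    [∀ i, TopologicalSpace (E i)] [∀ i, AddCommGroup (E i)] [∀ i, Module ℝ (E i)]
    [∀ i, ContinuousSMul ℝ (E i)]
    {g : ∀ i, E i → ℝ} (hg : ∀ i, IsGauge (g i)) {L K : Type*} [TopologicalSpace L]
    [TopologicalSpace K] {j : C(L, K)} {ℓ : ∀ i, C(E i, L)} {χ : ∀ i, C(E i, K)}
    (hK : IsCellAttachment g j ℓ χ) {x₀ : L} (hℓ : ∀ i w, 2 ≤ g i w → ℓ i w = x₀)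
    {D Y : ι → Type*} [∀ i, TopologicalSpace (D i)] [∀ i, TopologicalSpace (Y i)]
    {k : ∀ i, C(D i, Y i)} {c : ∀ i, C(E i, D i)} {ξ : ∀ i, C(E i, Y i)}
    (hY : ∀ i, IsCellAttachment (fun _ : Unit => g i) (k i) (fun _ => c i) (fun _ => ξ i))
    {p : ∀ i, D i} (C : ∀ i, C(D i × ℝ, D i)) (hC0 : ∀ i d, C i (d, 0) = d)
    (hC1 : ∀ i d t, 1 ≤ t → C i (d, t) = p i) (hCp : ∀ i t, C i (p i, t) = p i)
    (hc : ∀ i w (τ : ℝ), g i w = 1 → 1 ≤ τ → c i (τ • w) = C i (c i w, τ - 1)) :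
    Nonempty (K ≃ₕ Wedge (IndexedWedge.base Y (fun i => k i (p i))) x₀) := by
  classical
  have hgs := fun i => (hg i).map_smul
  have gc : ∀ i, Continuous (g i) := fun i => (hg i).continuous
  set q : ∀ i, Y i := fun i => k i (p i)
  choose F hF1 hF2 using fun i => hK.exists_extension gc i
  choose G hG1 hG2 using fun i => (hY i).exists_extension (fun _ => gc i) ()
  have hcp : ∀ i w, 2 ≤ g i w → c i w = p i := by
    intro i w hw
    have h0 : (0 : ℝ) < g i w := by linarith
    have h1 : g i ((g i w)⁻¹ • w) = 1 := by
      rw [hgs _ _ _ (by positivity)]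
      field_simp
    have := hc i _ (g i w) h1 (by linarith)
    rw [smul_smul, mul_inv_cancel₀ h0.ne', one_smul] at this
    rw [this, hC1 _ _ _ (by linarith)]
  have hGp : ∀ i w, 2 ≤ g i w → G i w = q i := fun i w hw => by
    rw [hG2 i w (by linarith), hcp i w hw]
  have hFp : ∀ i w, 2 ≤ g i w → F i w = j x₀ := fun i w hw => by
    rw [hF2 i w (by linarith), hℓ i w hw]
  have hbase := fun i => wedgeSummand_base (p := q) (x₀ := x₀) i
  -- The map `α : K → W`: the inner part of each cell covers `Y i`, the outer part runs back from
  -- the base point to the attaching map. In the composite `β ∘ α` below, both parts become the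
  -- dilation by the factor `15 - 14 * g`: it is `1` on the boundary, and at `g = 1 / 2` it is so
  -- large that both `G` (at half the dilation) and `ℓ` have reached the base point.
  have exα : ∀ i, ∃ ψ : C(E i, Wedge (IndexedWedge.base Y q) x₀),
      (∀ w, g i w ≤ 1 / 2 → ψ w = wedgeSummand q x₀ i (G i (((15 - 14 * g i w) / 2) • w))) ∧
      (∀ w, 1 / 2 ≤ g i w → ψ w = wedgeRest q x₀ (ℓ i ((15 - 14 * g i w) • w))) := by
    intro i
    have agree : ∀ w, g i w = 1 / 2 →
        wedgeSummand q x₀ i (G i (((15 - 14 * g i w) / 2) • w)) =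
          wedgeRest q x₀ (ℓ i ((15 - 14 * g i w) • w)) := by
      intro w hw
      rw [hGp, hbase, hℓ]
      · rw [hgs _ _ _ (by rw [hw]; norm_num), hw]; norm_num
      · rw [hgs _ _ _ (by rw [hw]; norm_num), hw]; norm_num
    refine ⟨⟨fun w => if g i w ≤ 1 / 2 then
        wedgeSummand q x₀ i (G i (((15 - 14 * g i w) / 2) • w)) else
        wedgeRest q x₀ (ℓ i ((15 - 14 * g i w) • w)), continuous_if_le (gc i) continuous_const
        ?_ ?_ agree⟩, fun w hw => if_pos hw, fun w hw => ?_⟩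
    · have := gc i
      exact Continuous.continuousOn (by fun_prop)
    · have := gc i
      exact Continuous.continuousOn (by fun_prop)
    · rcases hw.eq_or_lt with e | e
      · rw [← agree w e.symm]; exact if_pos e.symm.le
      · exact if_neg e.not_ge
  choose ψ hψ1 hψ2 using exα
  obtain ⟨α, hαL, hαc⟩ := hK.exists_desc (wedgeRest q x₀) ψ (by
    intro i w hw
    rw [hψ2 i w (by rw [hw]; norm_num), hw]
    norm_num)
  -- The map `β : W → K` collapses each `D i` to the base point.
  have exβ : ∀ i, ∃ b : C(Y i, K), (∀ d, b (k i d) = j x₀) ∧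
      ∀ w, g i w ≤ 1 → b (ξ i w) = F i ((2 : ℝ) • w) := by
    intro i
    obtain ⟨b, h1, h2⟩ := (hY i).exists_desc (ContinuousMap.const _ (j x₀))
      (fun _ => ⟨fun w => F i ((2 : ℝ) • w), by fun_prop⟩) (by
        intro _ w hw
        exact hFp i _ (by rw [hgs _ _ _ (by norm_num), hw]; norm_num))
    exact ⟨b, h1, h2 ()⟩
  choose b hbD hbc using exβ
  obtain ⟨β, hβY, hβL⟩ := exists_wedge_desc (p := q) (x₀ := x₀) b j (fun i => hbD i _)
  have hbG : ∀ i w, b i (G i w) = F i ((2 : ℝ) • w) := by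
    intro i w
    rcases le_total (g i w) 1 with h | h
    · rw [hG1 i w h, hbc i w h]
    · rw [hG2 i w h, hbD, hFp]
      rw [hgs _ _ _ (by norm_num)]; linarith
  -- The dilation factor of `β ∘ α` is deformed linearly to `1`.
  have hβα : (β.comp α).Homotopic (ContinuousMap.id K) := by
    have ex : ∀ i, ∃ Ψ : C(E i, C(I, K)), ∀ w (u : I),
        Ψ w u = F i (((1 - (u : ℝ)) * (15 - 14 * g i w) + u) • w) := fun i =>
      ⟨ContinuousMap.curry ⟨fun x : E i × I =>
        F i (((1 - (x.2 : ℝ)) * (15 - 14 * g i x.1) + x.2) • x.1), by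
          have := gc i
          fun_prop⟩, fun _ _ => rfl⟩
    choose Ψ hΨ using ex
    obtain ⟨Φ, hΦL, hΦc⟩ := hK.exists_desc
      (ContinuousMap.curry ⟨fun x : L × I => j x.1, by fun_prop⟩) Ψ (by
        intro i w hw
        ext u
        rw [hΨ, hw]
        have : (1 - (u : ℝ)) * (15 - 14 * 1) + u = 1 := by ring
        rw [this, one_smul, hF2 i w hw.ge]
        rfl)
    refine homotopic_of_paths Φ (fun x => ?_) (fun x => ?_)
    · refine hK.cases (P := fun x => Φ x 0 = β.comp α x) (fun y => ?_) (fun i w hw => ?_) x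
      · rw [hΦL, ContinuousMap.comp_apply, hαL, hβL]; rfl
      · rw [hΦc i w hw, hΨ, ContinuousMap.comp_apply, hαc i w hw]
        simp only [Set.Icc.coe_zero, sub_zero, one_mul, add_zero]
        rcases le_total (g i w) (1 / 2) with h | h
        · rw [hψ1 i w h, hβY, hbG, smul_smul]
          congr 2
          ring
        · rw [hψ2 i w h, hβL, hF2]
          rw [hgs _ _ _ (by linarith)]
          nlinarith
    · refine hK.cases (P := fun x => Φ x 1 = x) (fun y => ?_) (fun i w hw => ?_) x
      · rw [hΦL]; rfl
      · rw [hΦc i w hw, hΨ]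
        simp [hF1 i w hw]
  -- The composite `α ∘ β` is deformed in two steps: first the detour through `L` is retracted to
  -- the base point, then the contraction of `D i` is undone. The intermediate map is `μ`. On the
  -- cells it dilates by `max (15 - 28 * g) 8`, which agrees with `α ∘ β` for `g ≤ 1 / 4` and goes
  -- to the base point for `1 / 4 ≤ g`.
  have exm : ∀ i, ∃ m : C(Y i, Wedge (IndexedWedge.base Y q) x₀),
      (∀ d, m (k i d) = wedgeRest q x₀ x₀) ∧
      ∀ w, g i w ≤ 1 → m (ξ i w) = wedgeSummand q x₀ i (G i (max (15 - 28 * g i w) 8 • w)) := by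
    intro i
    obtain ⟨m, h1, h2⟩ := (hY i).exists_desc (ContinuousMap.const _ (wedgeRest q x₀ x₀))
      (fun _ => ⟨fun w => wedgeSummand q x₀ i (G i (max (15 - 28 * g i w) 8 • w)), by
        have := gc i
        fun_prop⟩) (by
        intro _ w hw
        change wedgeSummand q x₀ i (G i (max (15 - 28 * g i w) 8 • w)) = wedgeRest q x₀ x₀
        rw [hGp, hbase]
        rw [hgs _ _ _ (by positivity), hw]
        norm_num)
    exact ⟨m, h1, h2 ()⟩
  choose m hmD hmc using exm
  obtain ⟨μ, hμY, hμL⟩ := exists_wedge_desc (p := q) (x₀ := x₀) m (wedgeRest q x₀)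
    (fun i => hmD i _)
  have h8 : ∀ x : ℝ, 8 ≤ max (15 - 28 * x) 8 := fun x => le_max_right _ _
  have hαβ1 : (α.comp β).Homotopic μ := by
    have ex : ∀ i, ∃ Ψ : C(E i, C(I, Wedge (IndexedWedge.base Y q) x₀)), ∀ w (u : I),
        (g i w ≤ 1 / 4 → Ψ w u = wedgeSummand q x₀ i (G i ((15 - 28 * g i w) • w))) ∧
        (1 / 4 ≤ g i w → Ψ w u =
          wedgeRest q x₀ (ℓ i ((max (2 * (15 - 28 * g i w)) 2 + 8 * (u : ℝ)) • w))) := by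
      intro i
      have agree : ∀ x : E i × I, g i x.1 = 1 / 4 →
          wedgeSummand q x₀ i (G i ((15 - 28 * g i x.1) • x.1)) =
          wedgeRest q x₀ (ℓ i ((max (2 * (15 - 28 * g i x.1)) 2 + 8 * (x.2 : ℝ)) • x.1)) := by
        rintro ⟨w, u⟩ hw
        have hu : (0 : ℝ) ≤ u := u.2.1
        dsimp only at hw ⊢
        rw [hGp, hbase, hℓ]
        · rw [hgs _ _ _ (by positivity), hw]
          have : (2 * (15 - 28 * (1 / 4)) : ℝ) ≤ max (2 * (15 - 28 * (1 / 4))) 2 := le_max_left _ _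
          linarith
        · rw [hgs _ _ _ (by rw [hw]; norm_num), hw]; norm_num
      have hcont : Continuous (fun x : E i × I => if g i x.1 ≤ 1 / 4 then
          wedgeSummand q x₀ i (G i ((15 - 28 * g i x.1) • x.1)) else
          wedgeRest q x₀ (ℓ i ((max (2 * (15 - 28 * g i x.1)) 2 + 8 * (x.2 : ℝ)) • x.1))) := by
        have := gc i
        refine continuous_if_le (by fun_prop) continuous_const ?_ ?_ agree
        · exact Continuous.continuousOn (by fun_prop)
        · exact Continuous.continuousOn (by fun_prop)
      refine ⟨ContinuousMap.curry ⟨_, hcont⟩, fun w u => ⟨fun hw => if_pos hw, fun hw => ?_⟩⟩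
      rcases hw.eq_or_lt with e | e
      · rw [← agree (w, u) e.symm]; exact if_pos e.symm.le
      · exact if_neg e.not_ge
    choose Ψ hΨ using ex
    have exY : ∀ i, ∃ Φ : C(Y i, C(I, Wedge (IndexedWedge.base Y q) x₀)),
        (∀ d, Φ (k i d) = ContinuousMap.const _ (wedgeRest q x₀ x₀)) ∧
        ∀ w, g i w ≤ 1 → Φ (ξ i w) = Ψ i w := by
      intro i
      obtain ⟨Φ, h1, h2⟩ := (hY i).exists_desc
        (ContinuousMap.const _ (ContinuousMap.const _ (wedgeRest q x₀ x₀))) (fun _ => Ψ i) (by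
          intro _ w hw
          ext u
          have hu : (0 : ℝ) ≤ u := u.2.1
          rw [(hΨ i w u).2 (by rw [hw]; norm_num), hℓ]
          · rfl
          · rw [hgs _ _ _ (by positivity), hw]
            have : (2 : ℝ) ≤ max (2 * (15 - 28 * 1)) 2 := le_max_right _ _
            linarith)
      exact ⟨Φ, h1, h2 ()⟩
    choose Φ' hΦD hΦc using exY
    obtain ⟨Φ, hΦY, hΦL⟩ := exists_wedge_desc (p := q) (x₀ := x₀) Φ'
      (ContinuousMap.curry ⟨fun x : L × I => wedgeRest q x₀ x.1, by fun_prop⟩)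
      (fun i => (hΦD i (p i)).trans rfl)
    refine homotopic_of_paths Φ (fun x => ?_) (fun x => ?_)
    · refine wedge_cases (P := fun x => Φ x 0 = α.comp β x) (fun i y => ?_) (fun y => ?_) x
      · rw [hΦY, ContinuousMap.comp_apply, hβY]
        refine (hY i).cases (P := fun y => Φ' i y 0 = α (b i y)) (fun d => ?_)
          (fun _ w hw => ?_) y
        · rw [hΦD, hbD, hαL]; rfl
        · rw [hΦc i w hw, hbc i w hw]
          have h2w : g i ((2 : ℝ) • w) = 2 * g i w := hgs _ _ _ (by norm_num)
          rcases le_total (g i w) (1 / 4) with h | h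
          · rw [(hΨ i w 0).1 h, hF1 _ _ (by linarith), hαc _ _ (by linarith),
              hψ1 _ _ (by linarith), smul_smul, h2w]
            congr 3
            ring
          · rw [(hΨ i w 0).2 h]
            rcases le_total (g i w) (1 / 2) with h' | h'
            · rw [hF1 _ _ (by linarith), hαc _ _ (by linarith),
                hψ2 _ _ (by linarith), smul_smul, h2w, max_eq_left (by linarith)]
              congr 3
              simp
              ring
            · rw [hF2 _ _ (by linarith), hαL, max_eq_right (by linarith)]
              simp
      · rw [hΦL, ContinuousMap.comp_apply, hβL, hαL]; rfl
    · refine wedge_cases (P := fun x => Φ x 1 = μ x) (fun i y => ?_) (fun y => ?_) x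
      · rw [hΦY, hμY]
        refine (hY i).cases (P := fun y => Φ' i y 1 = m i y) (fun d => ?_) (fun _ w hw => ?_) y
        · rw [hΦD, hmD]; rfl
        · rw [hΦc i w hw, hmc i w hw]
          rcases le_total (g i w) (1 / 4) with h | h
          · rw [(hΨ i w 1).1 h, max_eq_left (by linarith)]
          · rw [(hΨ i w 1).2 h, hGp, hbase, hℓ]
            · simp only [Set.Icc.coe_one]
              rw [hgs _ _ _ (by positivity)]
              have : (2 : ℝ) ≤ max (2 * (15 - 28 * g i w)) 2 := le_max_right _ _
              nlinarith
            · rw [hgs _ _ _ (by positivity)]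
              nlinarith [h8 (g i w)]
      · rw [hΦL, hμL]; rfl
  have hαβ2 : μ.Homotopic (ContinuousMap.id _) := by
    have exY : ∀ i, ∃ Φ : C(Y i, C(I, Wedge (IndexedWedge.base Y q) x₀)),
        (∀ d (u : I), Φ (k i d) u = wedgeSummand q x₀ i (k i (C i (d, 7 * (1 - (u : ℝ)))))) ∧
        ∀ w, g i w ≤ 1 → ∀ u : I, Φ (ξ i w) u = wedgeSummand q x₀ i
          (G i (((1 - (u : ℝ)) * max (15 - 28 * g i w) 8 + u) • w)) := by
      intro i
      obtain ⟨Φ, h1, h2⟩ := (hY i).exists_desc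
        (ContinuousMap.curry ⟨fun x : D i × I =>
          wedgeSummand q x₀ i (k i (C i (x.1, 7 * (1 - (x.2 : ℝ))))), by fun_prop⟩)
        (fun _ => ContinuousMap.curry ⟨fun x : E i × I => wedgeSummand q x₀ i
          (G i (((1 - (x.2 : ℝ)) * max (15 - 28 * g i x.1) 8 + x.2) • x.1)), by
            have := gc i
            fun_prop⟩) (by
          intro _ w hw
          ext u
          change wedgeSummand q x₀ i
            (G i (((1 - (u : ℝ)) * max (15 - 28 * g i w) 8 + u) • w)) =
              wedgeSummand q x₀ i (k i (C i (c i w, 7 * (1 - (u : ℝ)))))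
          have hu : (u : ℝ) ≤ 1 := u.2.2
          have e : (1 - (u : ℝ)) * max (15 - 28 * g i w) 8 + u = 8 - 7 * u := by
            rw [max_eq_right (by linarith)]; ring
          rw [e, hG2, hc i w _ hw (by linarith)]
          · congr 4
            ring
          · rw [hgs _ _ _ (by linarith)]
            nlinarith)
      exact ⟨Φ, fun d u => by rw [h1]; rfl, fun w hw u => by rw [h2 () w hw]; rfl⟩
    choose Φ' hΦD hΦc using exY
    obtain ⟨Φ, hΦY, hΦL⟩ := exists_wedge_desc (p := q) (x₀ := x₀) Φ'
      (ContinuousMap.curry ⟨fun x : L × I => wedgeRest q x₀ x.1, by fun_prop⟩)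
      (fun i => by
        ext u
        refine (hΦD i (p i) u).trans ?_
        rw [hCp]
        exact hbase i)
    refine homotopic_of_paths Φ (fun x => ?_) (fun x => ?_)
    · refine wedge_cases (P := fun x => Φ x 0 = μ x) (fun i y => ?_) (fun y => ?_) x
      · rw [hΦY, hμY]
        refine (hY i).cases (P := fun y => Φ' i y 0 = m i y) (fun d => ?_) (fun _ w hw => ?_) y
        · rw [hΦD, hmD, hC1 _ _ _ (by norm_num)]
          exact hbase i
        · rw [hΦc i w hw, hmc i w hw]
          simp
      · rw [hΦL, hμL]; rfl
    · refine wedge_cases (P := fun x => Φ x 1 = x) (fun i y => ?_) (fun y => ?_) x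
      · rw [hΦY]
        refine (hY i).cases (P := fun y => Φ' i y 1 = wedgeSummand q x₀ i y)
          (fun d => ?_) (fun _ w hw => ?_) y
        · rw [hΦD]
          simp [hC0]
        · rw [hΦc i w hw]
          simp [hG1 i w hw]
      · rw [hΦL]; rfl
  exact ⟨⟨α, β, hβα, hαβ1.trans hαβ2⟩⟩

end Attach

/-! ### The cross-polytope -/

section CrossPolytope

open Finset

/-- The boundary of the cross-polytope, that is, the unit sphere of the `ℓ¹` norm. -/
def CrossPolytope (ι : Type*) [Fintype ι] : Set (ι → ℝ) := {v | ∑ e, |v e| = 1}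

/-- Radial projection to the unit sphere of the `ℓ¹` norm; junk value `0` at `0`. -/
noncomputable def l1Normalize {ι : Type*} [Fintype ι] (v : ι → ℝ) : ι → ℝ := (∑ e, |v e|)⁻¹ • v

variable {ι : Type*} [Fintype ι]

theorem sum_abs_pos {v : ι → ℝ} (hv : v ≠ 0) : 0 < ∑ e, |v e| := by
  obtain ⟨e, he⟩ := Function.ne_iff.mp hv
  exact sum_pos' (fun _ _ => abs_nonneg _) ⟨e, mem_univ _, abs_pos.mpr he⟩

theorem l1Normalize_mem {v : ι → ℝ} (hv : v ≠ 0) : l1Normalize v ∈ CrossPolytope ι := by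
  have h := sum_abs_pos hv
  change ∑ e, |(∑ e, |v e|)⁻¹ * v e| = 1
  simp_rw [abs_mul, ← mul_sum, abs_of_pos (inv_pos.mpr h)]
  exact inv_mul_cancel₀ h.ne'

theorem l1Normalize_of_mem {v : ι → ℝ} (hv : v ∈ CrossPolytope ι) : l1Normalize v = v := by
  have : ∑ e, |v e| = 1 := hv
  simp [l1Normalize, this]

theorem ne_zero_of_mem_crossPolytope {v : ι → ℝ} (hv : v ∈ CrossPolytope ι) : v ≠ 0 := by
  rintro rfl
  simp [CrossPolytope] at hv

theorem l1Normalize_nonpos {v : ι → ℝ} {e : ι} (h : v e ≤ 0) : l1Normalize v e ≤ 0 :=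
  mul_nonpos_of_nonneg_of_nonpos (inv_nonneg.mpr (sum_nonneg fun _ _ => abs_nonneg _)) h

theorem continuous_l1Normalize {A : Type*} [TopologicalSpace A] {f : A → ι → ℝ}
    (hf : Continuous f) (h0 : ∀ a, f a ≠ 0) : Continuous fun a => l1Normalize (f a) := by
  unfold l1Normalize
  exact Continuous.smul (Continuous.inv₀ (by fun_prop) fun a => (sum_abs_pos (h0 a)).ne') hf

theorem mem_crossPolytope_of_nonneg {v : ι → ℝ} (h : ∀ e, 0 ≤ v e) (hs : ∑ e, v e = 1) :
    v ∈ CrossPolytope ι := by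
  change ∑ e, |v e| = 1
  simp_rw [fun e => abs_of_nonneg (h e), hs]

variable (ι) in
/-- The vectors with coordinate sum zero: the directions of the standard simplex. -/
def sumZero : Submodule ℝ (ι → ℝ) where
  carrier := {w | ∑ e, w e = 0}
  add_mem' {a b} ha hb := by
    simp only [Set.mem_ofPred_eq] at *
    simp [sum_add_distrib, ha, hb]
  zero_mem' := by simp
  smul_mem' c w hw := by
    simp only [Set.mem_ofPred_eq] at *
    simp [← mul_sum, hw]

/-- Translation of a direction to a point of the hyperplane of coordinate sum one. -/
noncomputable def addBarycentre (w : sumZero ι) : ι → ℝ := fun e => (Fintype.card ι : ℝ)⁻¹ + w.1 e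

theorem continuous_addBarycentre : Continuous (addBarycentre : sumZero ι → ι → ℝ) := by
  unfold addBarycentre
  refine continuous_pi fun e => ?_
  exact continuous_const.add ((continuous_apply e).comp continuous_subtype_val)

theorem addBarycentre_injective : Function.Injective (addBarycentre : sumZero ι → ι → ℝ) := by
  intro w w' h
  ext e
  simpa [addBarycentre] using congrFun h e

variable (ι) in
/-- The cross-polytope without the open facet of the positive vectors. -/
def CrossRest : Set (ι → ℝ) := {v | v ∈ CrossPolytope ι ∧ ∃ e, v e ≤ 0}

theorem isCompact_crossPolytope : IsCompact (CrossPolytope ι) := by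
  refine Metric.isCompact_of_isClosed_isBounded ?_ ?_
  · exact isClosed_eq (by fun_prop) continuous_const
  · refine (Metric.isBounded_closedBall (x := (0 : ι → ℝ)) (r := 1)).subset fun v hv => ?_
    have hv : ∑ e, |v e| = 1 := hv
    rw [mem_closedBall_zero_iff, pi_norm_le_iff_of_nonneg zero_le_one]
    intro e
    rw [← hv]
    exact single_le_sum (f := fun e => |v e|) (fun _ _ => abs_nonneg _) (mem_univ e)

variable [Nonempty ι]

/-- The smallest coordinate of a vector. -/
noncomputable def minCoord (v : ι → ℝ) : ℝ := univ.inf' univ_nonempty v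

theorem le_minCoord {v : ι → ℝ} {a : ℝ} : a ≤ minCoord v ↔ ∀ e, a ≤ v e := by
  simp [minCoord]

theorem minCoord_le (v : ι → ℝ) (e : ι) : minCoord v ≤ v e := inf'_le _ (mem_univ e)

theorem exists_eq_minCoord (v : ι → ℝ) : ∃ e, v e = minCoord v := by
  obtain ⟨e, -, he⟩ := exists_mem_eq_inf' univ_nonempty v
  exact ⟨e, he.symm⟩

theorem minCoord_le_iff {v : ι → ℝ} {a : ℝ} : minCoord v ≤ a ↔ ∃ e, v e ≤ a := by
  simp [minCoord]

theorem continuous_minCoord : Continuous (minCoord : (ι → ℝ) → ℝ) :=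
  Continuous.finset_inf'_apply univ_nonempty fun e _ => continuous_apply e

theorem minCoord_smul {c : ℝ} (hc : 0 ≤ c) (v : ι → ℝ) : minCoord (c • v) = c * minCoord v := by
  apply le_antisymm
  · obtain ⟨e, he⟩ := exists_eq_minCoord v
    rw [← he]
    exact minCoord_le _ e
  · exact le_minCoord.mpr fun e => mul_le_mul_of_nonneg_left (minCoord_le v e) hc

/-- The gauge of the standard simplex with respect to its barycentre. -/
noncomputable def simplexGauge (w : sumZero ι) : ℝ := -(Fintype.card ι * minCoord w.1)

theorem isGauge_simplexGauge : IsGauge (simplexGauge : sumZero ι → ℝ) where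
  continuous := (continuous_const.mul (continuous_minCoord.comp continuous_subtype_val)).neg
  map_smul c w hc := by
    change -(_ * minCoord (c • w.1)) = _
    rw [minCoord_smul hc, simplexGauge]
    ring

theorem sum_addBarycentre (w : sumZero ι) : ∑ e, addBarycentre w e = 1 := by
  have h : ∑ e, w.1 e = 0 := w.2
  simp [addBarycentre, sum_add_distrib, h]

theorem addBarycentre_ne_zero (w : sumZero ι) : addBarycentre w ≠ 0 := by
  intro h
  have := sum_addBarycentre w
  simp [h] at this

theorem simplexGauge_le_one {w : sumZero ι} :
    simplexGauge w ≤ 1 ↔ ∀ e, 0 ≤ addBarycentre w e := by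
  have hd : (0 : ℝ) < Fintype.card ι := by exact_mod_cast Fintype.card_pos
  have : simplexGauge w ≤ 1 ↔ -(Fintype.card ι : ℝ)⁻¹ ≤ minCoord w.1 := by
    rw [simplexGauge, neg_le, inv_eq_one_div, ← neg_div, div_le_iff₀' hd]
  rw [this, le_minCoord]
  exact forall_congr' fun e => neg_le_iff_add_nonneg'

theorem one_le_simplexGauge {w : sumZero ι} :
    1 ≤ simplexGauge w ↔ ∃ e, addBarycentre w e ≤ 0 := by
  have hd : (0 : ℝ) < Fintype.card ι := by exact_mod_cast Fintype.card_pos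
  have : 1 ≤ simplexGauge w ↔ minCoord w.1 ≤ -(Fintype.card ι : ℝ)⁻¹ := by
    rw [simplexGauge, le_neg, inv_eq_one_div, ← neg_div, le_div_iff₀' hd]
  rw [this, minCoord_le_iff]
  exact exists_congr fun e => le_neg_iff_add_nonpos_left

theorem exists_addBarycentre_eq {v : ι → ℝ} (h : ∑ e, v e = 1) :
    ∃ w : sumZero ι, addBarycentre w = v := by
  refine ⟨⟨fun e => v e - (Fintype.card ι : ℝ)⁻¹, ?_⟩, ?_⟩
  · change ∑ e, (v e - (Fintype.card ι : ℝ)⁻¹) = 0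
    simp [sum_sub_distrib, h]
  · ext e
    simp [addBarycentre]

theorem isCompact_simplexGauge_le_one : IsCompact {w : sumZero ι | simplexGauge w ≤ 1} := by
  have h : Topology.IsClosedEmbedding (addBarycentre : sumZero ι → ι → ℝ) := by
    have h1 : Topology.IsClosedEmbedding (Subtype.val : sumZero ι → ι → ℝ) :=
      (Submodule.closed_of_finiteDimensional (sumZero ι)).isClosedEmbedding_subtypeVal
    exact (Homeomorph.addLeft (fun _ => (Fintype.card ι : ℝ)⁻¹)).isClosedEmbedding.comp h1
  have : {w : sumZero ι | simplexGauge w ≤ 1} = addBarycentre ⁻¹' stdSimplex ℝ ι := by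
    ext w
    simp [stdSimplex, simplexGauge_le_one, sum_addBarycentre]
  rw [this]
  exact h.isCompact_preimage (isCompact_stdSimplex ℝ ι)

/-- The standard simplex, centred at its barycentre, as a cell of the cross-polytope. Only the
values on the ball of `simplexGauge` matter. -/
noncomputable def crossCell : C(sumZero ι, CrossPolytope ι) where
  toFun w := ⟨l1Normalize (addBarycentre w), l1Normalize_mem (addBarycentre_ne_zero w)⟩
  continuous_toFun := (continuous_l1Normalize continuous_addBarycentre
    addBarycentre_ne_zero).subtype_mk _

theorem crossCell_eq {w : sumZero ι} (h : simplexGauge w ≤ 1) :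
    (crossCell w).1 = addBarycentre w :=
  l1Normalize_of_mem (mem_crossPolytope_of_nonneg (simplexGauge_le_one.mp h) (sum_addBarycentre w))

/-- Subtraction of twice the smallest coordinate, unless that coordinate is negative. It moves the
vectors of the open positive orthant out of it and fixes all others. -/
noncomputable def foldVector (v : ι → ℝ) : ι → ℝ := fun e => v e - 2 * max 0 (minCoord v)

theorem continuous_foldVector : Continuous (foldVector : (ι → ℝ) → ι → ℝ) := by
  unfold foldVector
  refine continuous_pi fun e => ?_
  have := continuous_minCoord (ι := ι)
  fun_prop

theorem foldVector_of_nonpos {v : ι → ℝ} (h : minCoord v ≤ 0) : foldVector v = v := by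
  ext e
  simp [foldVector, max_eq_left h]

theorem foldVector_nonpos (v : ι → ℝ) : ∃ e, foldVector v e ≤ 0 := by
  obtain ⟨e, he⟩ := exists_eq_minCoord v
  refine ⟨e, ?_⟩
  unfold foldVector
  rcases le_total 0 (minCoord v) with h | h
  · rw [max_eq_right h]; linarith
  · rw [max_eq_left h]; linarith

theorem foldVector_ne_zero {v : ι → ℝ} (hv : v ≠ 0) : foldVector v ≠ 0 := by
  intro h
  have h' : ∀ e, v e - 2 * max 0 (minCoord v) = 0 := fun e => congrFun h e
  have h0 : minCoord v ≤ 0 := by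
    obtain ⟨e, he⟩ := exists_eq_minCoord v
    have := h' e
    by_contra! h1
    rw [max_eq_right h1.le] at this
    linarith
  exact hv (foldVector_of_nonpos h0 ▸ h)

/-- Retraction of the cross-polytope to the complement of the open positive facet. -/
noncomputable def crossFold : C(CrossPolytope ι, CrossRest ι) where
  toFun v := ⟨l1Normalize (foldVector v.1),
    l1Normalize_mem (foldVector_ne_zero (ne_zero_of_mem_crossPolytope v.2)),
    (foldVector_nonpos v.1).imp fun _ => l1Normalize_nonpos⟩
  continuous_toFun := (continuous_l1Normalize (continuous_foldVector.comp continuous_subtype_val)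
    fun v => foldVector_ne_zero (ne_zero_of_mem_crossPolytope v.2)).subtype_mk _

theorem crossFold_of_nonpos {v : CrossPolytope ι} (h : ∃ e, v.1 e ≤ 0) :
    (crossFold v).1 = v.1 := by
  change l1Normalize _ = _
  rw [foldVector_of_nonpos (minCoord_le_iff.mpr h), l1Normalize_of_mem v.2]

variable (ι) in
/-- The barycentre of the facet opposite to the positive one. -/
noncomputable def crossCentre : CrossRest ι :=
  ⟨fun _ => -(Fintype.card ι : ℝ)⁻¹, by
    have hd : (0 : ℝ) < Fintype.card ι := by exact_mod_cast Fintype.card_pos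
    refine ⟨?_, Classical.arbitrary ι, by simp⟩
    change ∑ e : ι, |-(Fintype.card ι : ℝ)⁻¹| = 1
    simp [hd.ne']⟩

/-- The segment from `v` to the vector `crossCentre ι`; the parameter is clipped to `[0, 1]`. -/
noncomputable def toCentre (v : ι → ℝ) (t : ℝ) : ι → ℝ :=
  fun e => (1 - max 0 (min 1 t)) * v e - max 0 (min 1 t) * (Fintype.card ι : ℝ)⁻¹

theorem toCentre_nonpos {v : ι → ℝ} {e : ι} (h : v e ≤ 0) (t : ℝ) : toCentre v t e ≤ 0 := by
  have h1 : max 0 (min 1 t) ≤ 1 := max_le zero_le_one (min_le_left _ _)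
  have h2 : 0 ≤ max 0 (min 1 t) * (Fintype.card ι : ℝ)⁻¹ := by positivity
  have h3 := mul_nonpos_of_nonneg_of_nonpos (sub_nonneg.mpr h1) h
  unfold toCentre
  linarith

theorem toCentre_ne_zero {v : ι → ℝ} (hv : v ∈ CrossRest ι) (t : ℝ) : toCentre v t ≠ 0 := by
  intro h
  have hd : (0 : ℝ) < (Fintype.card ι : ℝ)⁻¹ := by
    have : (0 : ℝ) < Fintype.card ι := by exact_mod_cast Fintype.card_pos
    positivity
  have h' : ∀ e, (1 - max 0 (min 1 t)) * v e = max 0 (min 1 t) * (Fintype.card ι : ℝ)⁻¹ :=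
    fun e => sub_eq_zero.mp (congrFun h e)
  have h1 : max 0 (min 1 t) ≤ 1 := max_le zero_le_one (min_le_left _ _)
  have h0 : 0 ≤ max 0 (min 1 t) := le_max_left _ _
  generalize max 0 (min 1 t) = s at *
  obtain ⟨e, he⟩ := hv.2
  have hs : s = 0 := by
    have h2 := h' e
    have h3 := mul_nonpos_of_nonneg_of_nonpos (sub_nonneg.mpr h1) he
    by_contra hs
    have := mul_pos (lt_of_le_of_ne h0 (Ne.symm hs)) hd
    linarith
  refine ne_zero_of_mem_crossPolytope hv.1 (funext fun e => ?_)
  simpa [hs] using h' e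

/-- Contraction of the complement of the open positive facet to the opposite centre. -/
noncomputable def crossContract : C(CrossRest ι × ℝ, CrossRest ι) where
  toFun x := ⟨l1Normalize (toCentre x.1.1 x.2), l1Normalize_mem (toCentre_ne_zero x.1.2 _),
    x.1.2.2.imp fun _ h => l1Normalize_nonpos (toCentre_nonpos h _)⟩
  continuous_toFun := by
    refine (continuous_l1Normalize ?_ fun x => toCentre_ne_zero x.1.2 _).subtype_mk _
    unfold toCentre
    refine continuous_pi fun e => ?_
    have : Continuous fun x : CrossRest ι × ℝ => x.1.1 e :=
      (continuous_apply e).comp (continuous_subtype_val.comp continuous_fst)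
    fun_prop

theorem crossContract_zero (d : CrossRest ι) : crossContract (d, 0) = d := by
  ext1
  change l1Normalize (toCentre d.1 0) = d.1
  have : toCentre d.1 0 = d.1 := by
    ext e
    simp [toCentre]
  rw [this, l1Normalize_of_mem d.2.1]

theorem crossContract_of_one_le (d : CrossRest ι) {t : ℝ} (ht : 1 ≤ t) :
    crossContract (d, t) = crossCentre ι := by
  ext1
  change l1Normalize (toCentre d.1 t) = (crossCentre ι).1
  have : toCentre d.1 t = (crossCentre ι).1 := by
    ext e
    simp [toCentre, ht, crossCentre]
  rw [this, l1Normalize_of_mem (crossCentre ι).2.1]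

theorem crossContract_centre (t : ℝ) : crossContract (crossCentre ι, t) = crossCentre ι := by
  ext1
  change l1Normalize (toCentre (crossCentre ι).1 t) = (crossCentre ι).1
  have : toCentre (crossCentre ι).1 t = (crossCentre ι).1 := by
    ext e
    simp only [toCentre, crossCentre]
    ring
  rw [this, l1Normalize_of_mem (crossCentre ι).2.1]

/-- The attaching map of the positive facet, extended over the ball by folding and outside of the
ball by the contraction of its complement. -/
noncomputable def crossAttach : C(sumZero ι, CrossRest ι) where
  toFun w := crossContract (crossFold (crossCell ((max 1 (simplexGauge w))⁻¹ • w)),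
    simplexGauge w - 1)
  continuous_toFun := by
    have h1 := (isGauge_simplexGauge (ι := ι)).continuous
    have h2 : Continuous fun w : sumZero ι => (max 1 (simplexGauge w))⁻¹ :=
      Continuous.inv₀ (by fun_prop) fun w => (lt_max_of_lt_left one_pos).ne'
    fun_prop

theorem crossAttach_smul {w : sumZero ι} (hw : simplexGauge w = 1) {τ : ℝ} (hτ : 1 ≤ τ) :
    crossAttach (τ • w) = crossContract (crossFold (crossCell w), τ - 1) := by
  have h : simplexGauge (τ • w) = τ := by
    rw [isGauge_simplexGauge.map_smul _ _ (by linarith), hw, mul_one]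
  change crossContract (crossFold (crossCell ((max 1 (simplexGauge (τ • w)))⁻¹ • τ • w)),
    simplexGauge (τ • w) - 1) = _
  rw [h, max_eq_right hτ, smul_smul, inv_mul_cancel₀ (by linarith), one_smul]

theorem crossAttach_of_eq_one {w : sumZero ι} (hw : simplexGauge w = 1) :
    crossAttach w = crossFold (crossCell w) := by
  have := crossAttach_smul hw le_rfl
  rwa [one_smul, sub_self, crossContract_zero] at this

theorem crossAttach_of_two_le {w : sumZero ι} (hw : 2 ≤ simplexGauge w) :
    crossAttach w = crossCentre ι :=
  crossContract_of_one_le _ (by linarith)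

variable (ι) in
/-- The inclusion of the complement of the open positive facet. -/
def crossIncl : C(CrossRest ι, CrossPolytope ι) where
  toFun v := ⟨v.1, v.2.1⟩
  continuous_toFun := continuous_subtype_val.subtype_mk _

theorem crossIncl_crossAttach {w : sumZero ι} (hw : simplexGauge w = 1) :
    crossIncl ι (crossAttach w) = crossCell w := by
  ext1
  rw [crossAttach_of_eq_one hw]
  refine crossFold_of_nonpos ?_
  rw [crossCell_eq hw.le]
  exact one_le_simplexGauge.mp hw.ge

/-- The cross-polytope is the complement of the open positive facet with this facet attached. -/
theorem isCellAttachment_crossPolytope :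
    IsCellAttachment (fun _ : Unit => (simplexGauge : sumZero ι → ℝ)) (crossIncl ι)
      (fun _ => crossAttach) (fun _ => crossCell) where
  isQuotientMap := by
    have h1 : CompactSpace {w : sumZero ι // simplexGauge w ≤ 1} :=
      isCompact_iff_compactSpace.mp isCompact_simplexGauge_le_one
    have h2 : CompactSpace (CrossRest ι) := by
      have h : IsClosed {v : ι → ℝ | ∃ e, v e ≤ 0} := by
        have : {v : ι → ℝ | ∃ e, v e ≤ 0} = {v | minCoord v ≤ 0} := by
          ext v
          exact minCoord_le_iff.symm
        rw [this]
        exact isClosed_le continuous_minCoord continuous_const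
      exact isCompact_iff_compactSpace.mp (isCompact_crossPolytope.inter_right h)
    refine Topology.IsQuotientMap.of_surjective_continuous (fun v => ?_)
      ((crossIncl ι).continuous.sumElim
        (continuous_sigma fun _ => crossCell.continuous.comp continuous_subtype_val))
    by_cases hv : ∃ e, v.1 e ≤ 0
    · exact ⟨Sum.inl ⟨v.1, v.2, hv⟩, rfl⟩
    · push Not at hv
      have hs : ∑ e, v.1 e = 1 := by
        have : ∑ e, |v.1 e| = 1 := v.2
        simpa [fun e => abs_of_pos (hv e)] using this
      obtain ⟨w, hw⟩ := exists_addBarycentre_eq hs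
      have hg : simplexGauge w ≤ 1 :=
        simplexGauge_le_one.mpr (by simpa [hw] using fun e => (hv e).le)
      exact ⟨Sum.inr ⟨(), w, hg⟩, Subtype.ext ((crossCell_eq hg).trans hw)⟩
  compat _ w hw := (crossIncl_crossAttach hw).symm
  injective v v' h := Subtype.ext (congrArg (fun x => x.1) h :)
  cell_eq_base _ w v h hg := by
    refine hg.antisymm (one_le_simplexGauge.mpr ?_)
    rw [← crossCell_eq hg, h]
    exact v.2.2
  cell_eq_cell _ w _ w' h hg hg' := by
    left
    have := addBarycentre_injective
      ((crossCell_eq hg).symm.trans ((congrArg Subtype.val h).trans (crossCell_eq hg')))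
    rw [this]

end CrossPolytope

/-! ### The cross-polytope is a sphere -/

section Sphere

open Finset

variable {ι : Type*} [Fintype ι]

theorem l1Normalize_smul {c : ℝ} (hc : 0 < c) (v : ι → ℝ) :
    l1Normalize (c • v) = l1Normalize v := by
  have : ∑ e, |(c • v) e| = c * ∑ e, |v e| := by
    simp [abs_mul, mul_sum, abs_of_pos hc]
  rw [l1Normalize, this, smul_smul, mul_inv, mul_right_comm, inv_mul_cancel₀ hc.ne', one_mul]
  rfl

variable (ι) in
/-- Rescaling from the `ℓ¹` norm to the Euclidean norm. -/
noncomputable def crossPolytopeHomeomorph : CrossPolytope ι ≃ₜ UnitSphere (Fintype.card ι) := by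
  let T : (ι → ℝ) ≃L[ℝ] EuclideanSpace ℝ (Fin (Fintype.card ι)) :=
    (LinearEquiv.funCongrLeft ℝ ℝ (Fintype.equivFin ι).symm ≪≫ₗ
      (WithLp.linearEquiv 2 ℝ (Fin (Fintype.card ι) → ℝ)).symm).toContinuousLinearEquiv
  have h0 : ∀ v : CrossPolytope ι, T v.1 ≠ 0 := fun v =>
    (map_ne_zero_iff T T.injective).mpr (ne_zero_of_mem_crossPolytope v.2)
  have h1 : ∀ x : UnitSphere (Fintype.card ι), T.symm x.1 ≠ 0 := fun x => by
    refine (map_ne_zero_iff T.symm T.symm.injective).mpr fun h => ?_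
    have := x.2
    simp [h] at this
  exact
  { toFun := fun v => ⟨‖T v.1‖⁻¹ • T v.1, by
      rw [mem_sphere_zero_iff_norm, norm_smul, norm_inv, norm_norm,
        inv_mul_cancel₀ (norm_ne_zero_iff.mpr (h0 v))]⟩
    invFun := fun x => ⟨l1Normalize (T.symm x.1), l1Normalize_mem (h1 x)⟩
    left_inv := fun v => by
      ext1
      change l1Normalize (T.symm (‖T v.1‖⁻¹ • T v.1)) = v.1
      rw [map_smul, T.symm_apply_apply,
        l1Normalize_smul (inv_pos.mpr (norm_pos_iff.mpr (h0 v))), l1Normalize_of_mem v.2]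
    right_inv := fun x => by
      ext1
      have hx : ‖x.1‖ = 1 := mem_sphere_zero_iff_norm.mp x.2
      have hp := inv_pos.mpr (sum_abs_pos (h1 x))
      change ‖T (l1Normalize (T.symm x.1))‖⁻¹ • T (l1Normalize (T.symm x.1)) = x.1
      rw [l1Normalize, map_smul, T.apply_symm_apply, norm_smul, hx, mul_one, smul_smul,
        Real.norm_of_nonneg hp.le, inv_mul_cancel₀ hp.ne', one_smul]
    continuous_toFun := by
      have hT : Continuous fun v : CrossPolytope ι => T v.1 :=
        T.continuous.comp continuous_subtype_val
      exact ((hT.norm.inv₀ fun v => norm_ne_zero_iff.mpr (h0 v)).smul hT).subtype_mk _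
    continuous_invFun := (continuous_l1Normalize
      (T.symm.continuous.comp continuous_subtype_val) h1).subtype_mk _ }

/-- Reflections show that spheres are homogeneous. -/
theorem exists_unitSphere_homeomorph {d : ℕ} (x y : UnitSphere d) :
    ∃ e : UnitSphere d ≃ₜ UnitSphere d, e x = y := by
  let R := (Submodule.span ℝ {x.1 - y.1})ᗮ.reflection
  have hR : ∀ z, z ∈ UnitSphere d ↔ R z ∈ UnitSphere d := fun z => by
    rw [mem_sphere_zero_iff_norm, mem_sphere_zero_iff_norm, R.norm_map]
  refine ⟨R.toHomeomorph.subtype hR, Subtype.ext ?_⟩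
  exact Submodule.reflection_sub
    ((mem_sphere_zero_iff_norm.mp x.2).trans (mem_sphere_zero_iff_norm.mp y.2).symm)

theorem exists_crossPolytope_homeomorph {Z : Type*} [TopologicalSpace Z]
    (e : Z ≃ₜ UnitSphere (Fintype.card ι)) (v : CrossPolytope ι) (z : Z) :
    ∃ h : CrossPolytope ι ≃ₜ Z, h v = z := by
  obtain ⟨f, hf⟩ := exists_unitSphere_homeomorph (crossPolytopeHomeomorph ι v) (e z)
  exact ⟨(crossPolytopeHomeomorph ι).trans (f.trans e.symm), by simp [hf]⟩

end Sphere

/-! ### Cross-polytopes in independence complexes -/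

section IndepSpace

open Finset

theorem SimpleGraph.mem_indepSpace {V : Type*} [Fintype V] {G : SimpleGraph V} {x : V → ℝ} :
    x ∈ G.indepSpace ↔ (∀ v, 0 ≤ x v) ∧ ∑ v, x v = 1 ∧ ∀ u v, G.Adj u v → x u = 0 ∨ x v = 0 := by
  classical
  refine and_congr_right fun h0 => ⟨?_, fun ⟨h1, h2⟩ => ?_⟩
  · rintro ⟨s, hs, hx, h1⟩
    refine ⟨?_, fun u v huv => ?_⟩
    · rw [← h1]
      exact (sum_subset (subset_univ s) fun v _ hv => hx v hv).symm
    · by_contra! h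
      have hu : u ∈ s := by by_contra hu; exact h.1 (hx u hu)
      have hv : v ∈ s := by by_contra hv; exact h.2 (hx v hv)
      exact hs.2 hu hv huv.ne huv
  · refine ⟨univ.filter fun v => x v ≠ 0, ⟨?_, ?_⟩, ?_, ?_⟩
    · by_contra h
      rw [not_nonempty_iff_eq_empty, filter_eq_empty_iff] at h
      have : ∑ v, x v = 0 := sum_eq_zero fun v hv => by simpa using h hv
      linarith
    · intro u hu v hv _ huv
      simp only [coe_filter, mem_univ, true_and, Set.mem_ofPred_eq] at hu hv
      exact (h2 u v huv).elim hu hv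
    · intro v hv
      simpa using hv
    · rw [sum_filter_ne_zero, h1]

theorem SimpleGraph.single_mem_indepSpace {V : Type*} [Finite V] [DecidableEq V]
    (G : SimpleGraph V) (v : V) : (Pi.single v 1 : V → ℝ) ∈ G.indepSpace := by
  have := Fintype.ofFinite V
  refine mem_indepSpace.mpr ⟨fun u => ?_, by simp, fun u w huw => ?_⟩
  · by_cases hu : u = v
    · subst hu; simp
    · simp [hu]
  · by_cases hu : u = v
    · right
      exact Pi.single_eq_of_ne (fun hw => huw.ne (hu.trans hw.symm)) _
    · left
      exact Pi.single_eq_of_ne hu _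

theorem SimpleGraph.isCompact_indepSpace {V : Type*} [Finite V] (G : SimpleGraph V) :
    IsCompact G.indepSpace := by
  have := Fintype.ofFinite V
  have h : G.indepSpace = stdSimplex ℝ V ∩ {x | ∀ u v, G.Adj u v → x u = 0 ∨ x v = 0} := by
    ext x
    rw [SimpleGraph.mem_indepSpace, ← and_assoc]
    rfl
  rw [h]
  refine (isCompact_stdSimplex ℝ V).inter_right ?_
  simp only [Set.ofPred_forall]
  refine isClosed_iInter fun u => isClosed_iInter fun v => isClosed_iInter fun _ => ?_
  exact (isClosed_eq (continuous_apply u) continuous_const).union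
    (isClosed_eq (continuous_apply v) continuous_const)

/-- The edges `a e — b e` form an induced matching in `G` and are pairwise distinct. -/
structure IsIndexedMatching {V ι : Type*} (G : SimpleGraph V) (a b : ι → V) : Prop where
  adj_iff : ∀ e e', G.Adj (a e) (b e') ↔ e = e'
  not_adj_left : ∀ e e', ¬ G.Adj (a e) (a e')
  not_adj_right : ∀ e e', ¬ G.Adj (b e) (b e')

namespace IsIndexedMatching

variable {V ι : Type*} {G : SimpleGraph V} {a b : ι → V}

theorem left_injective (h : IsIndexedMatching G a b) : Function.Injective a := fun e e' he =>
  (h.adj_iff e e').mp (he ▸ (h.adj_iff e' e').mpr rfl)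

theorem right_injective (h : IsIndexedMatching G a b) : Function.Injective b := fun e e' he =>
  (h.adj_iff e e').mp (he ▸ (h.adj_iff e e).mpr rfl)

theorem left_ne_right (h : IsIndexedMatching G a b) (e e' : ι) : a e ≠ b e' := fun he =>
  h.not_adj_right e' e (he ▸ (h.adj_iff e e).mpr rfl)

end IsIndexedMatching

open Classical in
/-- The vector with the positive parts of the coordinates of `v` placed at the vertices `a e` and
the negative parts at the vertices `b e`. -/
noncomputable def crossVector {V ι : Type*} [Fintype ι] (a b : ι → V) (v : ι → ℝ) : V → ℝ :=
  fun x => ∑ e, ((if x = a e then max (v e) 0 else 0) + if x = b e then max (-v e) 0 else 0)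

section

variable {V ι : Type*} [Fintype ι] {G : SimpleGraph V} {a b : ι → V}

theorem continuous_crossVector : Continuous (crossVector a b) := by
  unfold crossVector
  refine continuous_pi fun x => continuous_finsetSum _ fun e _ => Continuous.add ?_ ?_ <;>
  · split_ifs <;> fun_prop

theorem crossVector_nonneg (v : ι → ℝ) (x : V) : 0 ≤ crossVector a b v x := by
  refine sum_nonneg fun e _ => add_nonneg ?_ ?_ <;> split_ifs <;> simp

theorem crossVector_left (h : IsIndexedMatching G a b) (v : ι → ℝ) (e : ι) :
    crossVector a b v (a e) = max (v e) 0 := by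
  classical
  simp [crossVector, h.left_ne_right, h.left_injective.eq_iff]

theorem crossVector_right (h : IsIndexedMatching G a b) (v : ι → ℝ) (e : ι) :
    crossVector a b v (b e) = max (-v e) 0 := by
  classical
  simp [crossVector, fun e e' => (h.left_ne_right e e').symm, h.right_injective.eq_iff]

theorem crossVector_of_notMem (v : ι → ℝ) {x : V} (ha : ∀ e, x ≠ a e) (hb : ∀ e, x ≠ b e) :
    crossVector a b v x = 0 := by
  simp [crossVector, ha, hb]

theorem sum_crossVector [Fintype V] (v : ι → ℝ) :
    ∑ x : V, crossVector a b v x = ∑ e, |v e| := by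
  classical
  unfold crossVector
  rw [sum_comm]
  refine sum_congr rfl fun e _ => ?_
  rw [sum_add_distrib]
  simp only [sum_ite_eq', mem_univ, if_true]
  rcases le_total 0 (v e) with h | h
  · rw [max_eq_left h, max_eq_right (by linarith), abs_of_nonneg h, add_zero]
  · rw [max_eq_right h, max_eq_left (by linarith), abs_of_nonpos h, zero_add]

/-- The support of `crossVector a b v` is independent, since it contains at most one end of each
edge of an induced matching. -/
theorem crossVector_indep (h : IsIndexedMatching G a b) (v : ι → ℝ) {x y : V} (hxy : G.Adj x y) :
    crossVector a b v x = 0 ∨ crossVector a b v y = 0 := by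
  have cases : ∀ z, crossVector a b v z = 0 ∨ (∃ e, z = a e) ∨ ∃ e, z = b e := fun z => by
    by_contra! hz
    exact hz.1 (crossVector_of_notMem v hz.2.1 hz.2.2)
  have key : ∀ e, crossVector a b v (a e) = 0 ∨ crossVector a b v (b e) = 0 := fun e => by
    rw [crossVector_left h, crossVector_right h]
    rcases le_total 0 (v e) with h | h
    · right; exact max_eq_right (by linarith)
    · left; exact max_eq_right h
  rcases cases x with hx | ⟨e, rfl⟩ | ⟨e, rfl⟩
  · exact Or.inl hx
  · rcases cases y with hy | ⟨e', rfl⟩ | ⟨e', rfl⟩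
    · exact Or.inr hy
    · exact (h.not_adj_left _ _ hxy).elim
    · obtain rfl := (h.adj_iff e e').mp hxy
      exact key e
  · rcases cases y with hy | ⟨e', rfl⟩ | ⟨e', rfl⟩
    · exact Or.inr hy
    · obtain rfl := (h.adj_iff e' e).mp hxy.symm
      exact (key e').symm
    · exact (h.not_adj_right _ _ hxy).elim

variable [Finite V]

theorem crossVector_mem (h : IsIndexedMatching G a b) {v : ι → ℝ} (hv : v ∈ CrossPolytope ι) :
    crossVector a b v ∈ G.indepSpace := by
  have := Fintype.ofFinite V
  exact SimpleGraph.mem_indepSpace.mpr ⟨crossVector_nonneg _,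
    (sum_crossVector _).trans hv, fun _ _ => crossVector_indep h _⟩

/-- The embedding of the cross-polytope as the independence complex of an induced matching. -/
noncomputable def crossMap (h : IsIndexedMatching G a b) : C(CrossPolytope ι, G.indepSpace) where
  toFun v := ⟨crossVector a b v.1, crossVector_mem h v.2⟩
  continuous_toFun := (continuous_crossVector.comp continuous_subtype_val).subtype_mk _

theorem SimpleGraph.sum_indepSpace {V : Type*} [Fintype V] {G : SimpleGraph V}
    (x : G.indepSpace) : ∑ v, x.1 v = 1 := (mem_indepSpace.mp x.2).2.1

theorem SimpleGraph.eq_zero_or_of_adj {V : Type*} [Finite V] {G : SimpleGraph V}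
    (x : G.indepSpace) {u v : V} (h : G.Adj u v) : x.1 u = 0 ∨ x.1 v = 0 := by
  have := Fintype.ofFinite V
  exact (mem_indepSpace.mp x.2).2.2 u v h

/-- A point of the independence complex that is supported on the vertices of an induced matching
is determined by the differences of its values along the edges. -/
theorem crossVector_sub (h : IsIndexedMatching G a b) (x : G.indepSpace)
    (hx : ∀ y, (∀ e, y ≠ a e) → (∀ e, y ≠ b e) → x.1 y = 0) :
    crossVector a b (fun e => x.1 (a e) - x.1 (b e)) = x.1 := by
  ext y
  by_cases ha : ∃ e, y = a e
  · obtain ⟨e, rfl⟩ := ha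
    rw [crossVector_left h]
    have h1 := x.2.1 (a e)
    have h2 := x.2.1 (b e)
    rcases SimpleGraph.eq_zero_or_of_adj x ((h.adj_iff e e).mpr rfl) with h0 | h0 <;>
      simp [h0, h1, h2]
  by_cases hb : ∃ e, y = b e
  · obtain ⟨e, rfl⟩ := hb
    rw [crossVector_right h]
    have h1 := x.2.1 (a e)
    have h2 := x.2.1 (b e)
    rcases SimpleGraph.eq_zero_or_of_adj x ((h.adj_iff e e).mpr rfl) with h0 | h0 <;>
      simp [h0, h1, h2]
  push Not at ha hb
  rw [hx y ha hb, crossVector_of_notMem _ ha hb]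

/-- The independence complex of a perfect induced matching is a cross-polytope. -/
theorem nonempty_crossPolytope_homeomorph_indepSpace (h : IsIndexedMatching G a b)
    (hV : ∀ x, (∃ e, x = a e) ∨ ∃ e, x = b e) : Nonempty (CrossPolytope ι ≃ₜ G.indepSpace) := by
  have := Fintype.ofFinite V
  have hc : CompactSpace (CrossPolytope ι) := isCompact_iff_compactSpace.mp isCompact_crossPolytope
  have hinj : Function.Injective (crossMap h) := fun v v' hv => by
    ext e
    have h1 : crossVector a b v.1 = crossVector a b v'.1 := congrArg Subtype.val hv
    have h2 := congrFun h1 (a e)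
    have h3 := congrFun h1 (b e)
    rw [crossVector_left h, crossVector_left h] at h2
    rw [crossVector_right h, crossVector_right h] at h3
    rw [← max_zero_sub_max_neg_zero_eq_self (v.1 e), ← max_zero_sub_max_neg_zero_eq_self (v'.1 e)]
    simp only [h2, h3]
  have hsurj : Function.Surjective (crossMap h) := fun x => by
    have h1 := crossVector_sub h x fun y ha hb => ((hV y).elim (fun ⟨e, he⟩ => ha e he)
      fun ⟨e, he⟩ => hb e he).elim
    refine ⟨⟨fun e => x.1 (a e) - x.1 (b e), ?_⟩, Subtype.ext h1⟩
    change ∑ e, |x.1 (a e) - x.1 (b e)| = 1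
    rw [← sum_crossVector (a := a) (b := b) (V := V), h1]
    exact SimpleGraph.sum_indepSpace x
  exact ⟨(crossMap h).continuous.homeoOfEquivCompactToT2
    (f := Equiv.ofBijective _ ⟨hinj, hsurj⟩)⟩

end

end IndepSpace

/-! ### Folding facets -/

section Fold

open Finset

variable {V ι : Type*} {G : SimpleGraph V} {a b : ι → V}

/-- If all `a e` are in the support of a point and the `a e` dominate `G`, then the support
consists of the `a e` only. -/
theorem eq_zero_of_forall_pos [Finite V]
    (hdom : ∀ v, (∃ e, v = a e) ∨ ∃ e, G.Adj v (a e)) {x : G.indepSpace}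
    (hx : ∀ e, 0 < x.1 (a e)) {y : V} (hy : ∀ e, y ≠ a e) : x.1 y = 0 := by
  rcases hdom y with ⟨e, he⟩ | ⟨e, he⟩
  · exact (hy e he).elim
  · exact (SimpleGraph.eq_zero_or_of_adj x he).resolve_right (hx e).ne'

variable [Fintype ι]

theorem crossVector_smul {c : ℝ} (hc : 0 ≤ c) (v : ι → ℝ) :
    crossVector a b (c • v) = c • crossVector a b v := by
  ext x
  simp only [crossVector, Pi.smul_apply, smul_eq_mul, mul_sum]
  refine sum_congr rfl fun e _ => ?_
  rw [mul_add, mul_ite, mul_ite, mul_max_of_nonneg _ _ hc, mul_max_of_nonneg _ _ hc]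
  simp

theorem crossVector_restrict [Finite V] (h : IsIndexedMatching G a b)
    (hdom : ∀ v, (∃ e, v = a e) ∨ ∃ e, G.Adj v (a e)) {x : G.indepSpace}
    (hx : ∀ e, 0 < x.1 (a e)) : crossVector a b (fun e => x.1 (a e)) = x.1 := by
  have hb : ∀ e, x.1 (b e) = 0 := fun e =>
    eq_zero_of_forall_pos hdom hx fun e' => (h.left_ne_right e' e).symm
  have := crossVector_sub h x fun y hy _ => eq_zero_of_forall_pos hdom hx hy
  simpa [hb] using this

/-- Before normalization, the fold of a facet of the independence complex: a point of the open
facet spanned by the `a e` is folded over to the opposite side of its cross-polytope, and every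
other point is fixed. -/
noncomputable def preFold [Nonempty ι] (a b : ι → V) (x : V → ℝ) : V → ℝ :=
  x + crossVector a b (foldVector fun e => x (a e)) - crossVector a b (fun e => x (a e))

variable [Nonempty ι]

theorem preFold_of_nonpos {x : V → ℝ} (hx : ∃ e, x (a e) ≤ 0) : preFold a b x = x := by
  rw [preFold, foldVector_of_nonpos (minCoord_le_iff.mpr hx), add_sub_cancel_right]

variable [Finite V]

theorem preFold_of_pos (h : IsIndexedMatching G a b)
    (hdom : ∀ v, (∃ e, v = a e) ∨ ∃ e, G.Adj v (a e)) {x : G.indepSpace}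
    (hx : ∀ e, 0 < x.1 (a e)) :
    preFold a b x.1 = crossVector a b (foldVector fun e => x.1 (a e)) := by
  rw [preFold, crossVector_restrict h hdom hx, add_sub_cancel_left]

/-- After normalization, `preFold` either fixes a point or moves it from the open facet to the
rest of the cross-polytope. -/
theorem normalize_preFold [Fintype V] (h : IsIndexedMatching G a b)
    (hdom : ∀ v, (∃ e, v = a e) ∨ ∃ e, G.Adj v (a e)) (x : G.indepSpace) :
    0 < ∑ y, preFold a b x.1 y ∧
    (((∃ e, x.1 (a e) ≤ 0) ∧ (∑ y, preFold a b x.1 y)⁻¹ • preFold a b x.1 = x.1) ∨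
    ((∀ e, 0 < x.1 (a e)) ∧ ∃ v ∈ CrossRest ι,
      (∑ y, preFold a b x.1 y)⁻¹ • preFold a b x.1 = crossVector a b v)) := by
  by_cases hx : ∃ e, x.1 (a e) ≤ 0
  · rw [preFold_of_nonpos hx, SimpleGraph.sum_indepSpace]
    exact ⟨one_pos, Or.inl ⟨hx, by simp⟩⟩
  · push Not at hx
    have h0 : (fun e => x.1 (a e)) ≠ 0 := fun h0 =>
      (hx (Classical.arbitrary ι)).ne' (congrFun h0 (Classical.arbitrary ι))
    have h1 := sum_abs_pos (foldVector_ne_zero h0)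
    rw [preFold_of_pos h hdom hx, sum_crossVector]
    refine ⟨h1, Or.inr ⟨hx, l1Normalize (foldVector fun e => x.1 (a e)),
      ⟨l1Normalize_mem (foldVector_ne_zero h0),
        (foldVector_nonpos _).imp fun _ => l1Normalize_nonpos⟩, ?_⟩⟩
    rw [l1Normalize, crossVector_smul (inv_nonneg.mpr h1.le)]

/-- The independence complex can be retracted off an open facet spanned by a dominating side of an
induced matching, in such a way that the points moved stay in the cross-polytope of the matching. -/
theorem exists_fold (h : IsIndexedMatching G a b)
    (hdom : ∀ v, (∃ e, v = a e) ∨ ∃ e, G.Adj v (a e)) :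
    ∃ f : C(G.indepSpace, G.indepSpace), (∀ x, ∃ e, (f x).1 (a e) = 0) ∧
      (∀ x : G.indepSpace, (∃ e, x.1 (a e) = 0) → f x = x) ∧
      ∀ x, f x ≠ x → ∀ y, (∀ e, y ≠ a e) → (∀ e, y ≠ b e) → (f x).1 y = 0 := by
  have := Fintype.ofFinite V
  have hf := fun x => normalize_preFold h hdom x
  have hmem : ∀ x : G.indepSpace,
      (∑ y, preFold a b x.1 y)⁻¹ • preFold a b x.1 ∈ G.indepSpace := fun x => by
    rcases (hf x).2 with ⟨-, h1⟩ | ⟨-, v, hv, h1⟩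
    · rw [h1]; exact x.2
    · rw [h1]; exact crossVector_mem h hv.1
  have hcont : Continuous fun x : G.indepSpace => preFold a b x.1 := by
    unfold preFold
    have h1 : Continuous fun x : G.indepSpace => fun e => x.1 (a e) :=
      continuous_pi fun e => (continuous_apply _).comp continuous_subtype_val
    exact (continuous_subtype_val.add (continuous_crossVector.comp
      (continuous_foldVector.comp h1))).sub (continuous_crossVector.comp h1)
  refine ⟨⟨fun x => ⟨_, hmem x⟩, ?_⟩, fun x => ?_, fun x hx => ?_, fun x hx y ha hb => ?_⟩
  · exact (((continuous_finsetSum _ fun y _ => (continuous_apply y).comp hcont).inv₀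
      fun x => (hf x).1.ne').smul hcont).subtype_mk _
  · rcases (hf x).2 with ⟨⟨e, he⟩, h1⟩ | ⟨-, v, hv, h1⟩
    · exact ⟨e, (congrFun h1 (a e)).trans (he.antisymm (x.2.1 _))⟩
    · obtain ⟨e, he⟩ := hv.2
      exact ⟨e, (congrFun h1 (a e)).trans ((crossVector_left h _ _).trans (max_eq_right he))⟩
  · rcases (hf x).2 with ⟨-, h1⟩ | ⟨h1, -⟩
    · exact Subtype.ext h1
    · obtain ⟨e, he⟩ := hx
      exact ((h1 e).ne' he).elim
  · rcases (hf x).2 with ⟨-, h1⟩ | ⟨-, v, hv, h1⟩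
    · exact (hx (Subtype.ext h1)).elim
    · exact (congrFun h1 y).trans (crossVector_of_notMem _ ha hb)

end Fold

/-! ### Splitting off spheres -/

section Splitting

open Finset

/-- A sequence of induced matchings in `G` with edges `a i e — b i e` such that the vertices `a i e`
dominate `G` and that, for `i < j`, some `a j e` is not a vertex of the `i`-th matching. -/
structure IsMatchingSequence {V : Type*} (G : SimpleGraph V) {k : ℕ} {ι : Fin k → Type*}
    (a b : ∀ i, ι i → V) : Prop where
  matching : ∀ i, IsIndexedMatching G (a i) (b i)
  dominating : ∀ i v, (∃ e, v = a i e) ∨ ∃ e, G.Adj v (a i e)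
  exists_notMem : ∀ i j, i < j → ∃ e, (∀ e', a j e ≠ a i e') ∧ ∀ e', a j e ≠ b i e'

variable {V : Type*} [Finite V] {G : SimpleGraph V} {k : ℕ} {ι : Fin k → Type*}
  {a b : ∀ i, ι i → V}

variable (G a) in
/-- The independence complex without the open facets spanned by the `a i e`, for each `i`. -/
def indepRest : Set (V → ℝ) := {x | x ∈ G.indepSpace ∧ ∀ i, ∃ e, x (a i e) = 0}

variable (G a) in
/-- The inclusion of `indepRest` into the independence complex. -/
def indepRestIncl : C(indepRest G a, G.indepSpace) where
  toFun x := ⟨x.1, x.2.1⟩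
  continuous_toFun := continuous_subtype_val.subtype_mk _

namespace IsMatchingSequence

/-- A point of the `i`-th closed facet that has positive coordinates on the `j`-th facet lies in the
interior of the `i`-th facet, and `i = j`: no facet is contained in another one. -/
theorem facet_maximal (h : IsMatchingSequence G a b) {i j : Fin k} {x : G.indepSpace}
    (hx : ∀ y, (∀ e, y ≠ a i e) → x.1 y = 0)
    (hj : ∀ e, 0 < x.1 (a j e)) : i = j ∧ ∀ e, 0 < x.1 (a i e) := by
  have hji : ∀ e, ∃ e', a j e = a i e' := fun e => by
    by_contra! h1
    exact (hj e).ne' (hx _ h1)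
  have hij : ∀ e, ∃ e', a i e = a j e' := fun e => by
    rcases h.dominating j (a i e) with h1 | ⟨e', h1⟩
    · exact h1
    · obtain ⟨e'', h2⟩ := hji e'
      exact ((h.matching i).not_adj_left e e'' (h2 ▸ h1)).elim
  refine ⟨?_, fun e => ?_⟩
  · rcases lt_trichotomy i j with h1 | h1 | h1
    · obtain ⟨e, he, -⟩ := h.exists_notMem i j h1
      obtain ⟨e', h2⟩ := hji e
      exact (he e' h2).elim
    · exact h1
    · obtain ⟨e, he, -⟩ := h.exists_notMem j i h1
      obtain ⟨e', h2⟩ := hij e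
      exact (he e' h2).elim
  · obtain ⟨e', h1⟩ := hij e
    rw [h1]
    exact hj e'

variable [∀ i, Fintype (ι i)] [∀ i, Nonempty (ι i)]

/-- Folding the facets from the last one to the first one retracts the independence complex to the
complement of the open facets: the fold of the `j`-th facet does not meet the later open facets. -/
theorem exists_retraction (h : IsMatchingSequence G a b) :
    ∃ r : C(G.indepSpace, indepRest G a), ∀ x (hx : x.1 ∈ indepRest G a), r x = ⟨x.1, hx⟩ := by
  have key : ∀ n ≤ k, ∃ r : C(G.indepSpace, G.indepSpace),
      (∀ x : G.indepSpace, (∀ i, ∃ e, x.1 (a i e) = 0) → r x = x) ∧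
      ∀ x (j : Fin k), k ≤ j + n → ∃ e, (r x).1 (a j e) = 0 := by
    intro n
    induction n with
    | zero => exact fun _ => ⟨ContinuousMap.id _, fun _ _ => rfl, fun x j hj => by omega⟩
    | succ n ih =>
      intro hn
      obtain ⟨r, hr1, hr2⟩ := ih (by omega)
      let i : Fin k := ⟨k - (n + 1), by omega⟩
      obtain ⟨f, hf1, hf2, hf3⟩ := exists_fold (h.matching i) (h.dominating i)
      refine ⟨f.comp r, fun x hx => ?_, fun x j hj => ?_⟩
      · rw [ContinuousMap.comp_apply, hr1 x hx, hf2 x (hx i)]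
      · rw [ContinuousMap.comp_apply]
        rcases eq_or_ne j i with rfl | hji
        · exact hf1 _
        · have hij : i < j := by
            have h1 : (j : ℕ) ≠ k - (n + 1) := fun h => hji (Fin.ext h)
            exact Fin.mk_lt_of_lt_val (by omega)
          by_cases hfx : f (r x) = r x
          · rw [hfx]
            have h1 : (k - (n + 1) : ℕ) < j := hij
            exact hr2 x j (by omega)
          · obtain ⟨e, he1, he2⟩ := h.exists_notMem i j hij
            exact ⟨e, hf3 _ hfx _ he1 he2⟩
  obtain ⟨r, hr1, hr2⟩ := key k le_rfl
  exact ⟨⟨fun x => ⟨(r x).1, (r x).2, fun i => hr2 x i (by omega)⟩,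
    (continuous_subtype_val.comp r.continuous).subtype_mk _⟩,
    fun x hx => Subtype.ext (congrArg (fun y => y.1) (hr1 x hx.2) :)⟩

/-- The characteristic map of the facet spanned by the `a i e`, continued radially. -/
noncomputable def cell (h : IsMatchingSequence G a b) (i : Fin k) :
    C(sumZero (ι i), G.indepSpace) :=
  (crossMap (h.matching i)).comp crossCell

variable (h : IsMatchingSequence G a b)
include h

theorem cell_left {i : Fin k} {w : sumZero (ι i)} (hw : simplexGauge w ≤ 1) (e : ι i) :
    (h.cell i w).1 (a i e) = addBarycentre w e := by
  change crossVector _ _ (crossCell w).1 _ = _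
  rw [crossCell_eq hw, crossVector_left (h.matching i), max_eq_left (simplexGauge_le_one.mp hw e)]

theorem cell_of_ne {i : Fin k} {w : sumZero (ι i)} (hw : simplexGauge w ≤ 1) {y : V}
    (hy : ∀ e, y ≠ a i e) : (h.cell i w).1 y = 0 := by
  change crossVector _ _ (crossCell w).1 _ = _
  rw [crossCell_eq hw]
  by_cases hb : ∃ e, y = b i e
  · obtain ⟨e, rfl⟩ := hb
    rw [crossVector_right (h.matching i), max_eq_right]
    simpa using simplexGauge_le_one.mp hw e
  · push Not at hb
    exact crossVector_of_notMem _ hy hb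

theorem cell_mem_indepRest {i : Fin k} {w : sumZero (ι i)} (hw : simplexGauge w = 1) :
    (h.cell i w).1 ∈ indepRest G a := by
  refine ⟨(h.cell i w).2, fun j => ?_⟩
  by_contra! hj
  have hj' : ∀ e, 0 < (h.cell i w).1 (a j e) := fun e => ((h.cell i w).2.1 _).lt_of_ne' (hj e)
  obtain ⟨-, h1⟩ := h.facet_maximal (fun y hy => h.cell_of_ne hw.le hy) hj'
  obtain ⟨e, he⟩ := one_le_simplexGauge.mp hw.ge
  rw [← h.cell_left hw.le] at he
  exact (h1 e).not_ge he

/-- The independence complex is obtained from `indepRest` by attaching the facets. -/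
theorem isCellAttachment {ℓ : ∀ i, C(sumZero (ι i), indepRest G a)}
    (hℓ : ∀ i w, simplexGauge w = 1 → h.cell i w = indepRestIncl G a (ℓ i w)) :
    IsCellAttachment (fun i => (simplexGauge : sumZero (ι i) → ℝ)) (indepRestIncl G a) ℓ
      h.cell where
  isQuotientMap := by
    have h1 : ∀ i, CompactSpace {w : sumZero (ι i) // simplexGauge w ≤ 1} := fun i =>
      isCompact_iff_compactSpace.mp isCompact_simplexGauge_le_one
    have h2 : CompactSpace (indepRest G a) := by
      have hcl : IsClosed {x : V → ℝ | ∀ i, ∃ e, x (a i e) = 0} := by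
        simp only [Set.ofPred_forall, Set.ofPred_exists]
        exact isClosed_iInter fun i => isClosed_iUnion_of_finite fun e =>
          isClosed_eq (continuous_apply _) continuous_const
      exact isCompact_iff_compactSpace.mp (G.isCompact_indepSpace.inter_right hcl)
    refine Topology.IsQuotientMap.of_surjective_continuous (fun x => ?_)
      ((indepRestIncl G a).continuous.sumElim
        (continuous_sigma fun i => (h.cell i).continuous.comp continuous_subtype_val))
    by_cases hx : ∀ i, ∃ e, x.1 (a i e) = 0
    · exact ⟨Sum.inl ⟨x.1, x.2, hx⟩, rfl⟩
    · push Not at hx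
      obtain ⟨i, hi⟩ := hx
      have hpos : ∀ e, 0 < x.1 (a i e) := fun e => (x.2.1 _).lt_of_ne' (hi e)
      have hv := crossVector_restrict (h.matching i) (h.dominating i) hpos
      have hs : ∑ e, x.1 (a i e) = 1 := by
        have := Fintype.ofFinite V
        have h3 := sum_crossVector (a := a i) (b := b i) fun e => x.1 (a i e)
        rw [hv, SimpleGraph.sum_indepSpace] at h3
        rw [h3]
        exact sum_congr rfl fun e _ => (abs_of_pos (hpos e)).symm
      obtain ⟨w, hw⟩ := exists_addBarycentre_eq hs
      have hg : simplexGauge w ≤ 1 :=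
        simplexGauge_le_one.mpr fun e => by rw [hw]; exact (hpos e).le
      refine ⟨Sum.inr ⟨i, w, hg⟩, Subtype.ext ?_⟩
      change crossVector _ _ (crossCell w).1 = x.1
      rw [crossCell_eq hg, hw, hv]
  compat := hℓ
  injective x y hxy := Subtype.ext (congrArg (fun x => x.1) hxy :)
  cell_eq_base i w y hy hg := by
    refine hg.antisymm (one_le_simplexGauge.mpr ?_)
    obtain ⟨e, he⟩ := y.2.2 i
    refine ⟨e, ?_⟩
    rw [← h.cell_left hg, hy]
    exact he.le
  cell_eq_cell i w i' w' hww hg hg' := by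
    have key : ∀ i w i' w', h.cell i w = h.cell i' w' → simplexGauge w ≤ 1 →
        simplexGauge w' ≤ 1 → i ≠ i' → simplexGauge w = 1 := by
      intro i w i' w' hww hg hg' hne
      by_contra h1
      have h2 : ∀ e, 0 < addBarycentre w e := by
        have := mt one_le_simplexGauge.mpr (not_le.mpr (lt_of_le_of_ne hg h1))
        push Not at this
        exact this
      refine hne (h.facet_maximal (x := h.cell i w) (j := i) (i := i') ?_ fun e => ?_).1.symm
      · rw [hww]
        exact fun y hy => h.cell_of_ne hg' hy
      · rw [h.cell_left hg]
        exact h2 e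
    by_cases hi : i = i'
    · subst hi
      left
      have : addBarycentre w = addBarycentre w' := funext fun e => by
        rw [← h.cell_left hg, ← h.cell_left hg', hww]
      rw [addBarycentre_injective this]
    · exact Or.inr ⟨key i w i' w' hww hg hg' hi, key i' w' i w hww.symm hg' hg (Ne.symm hi)⟩

/-- The attaching maps of the facets extend continuously over all of `sumZero (ι i)`, with one and
the same constant value outside of larger balls. -/
theorem exists_attaching [Nonempty V]
    (hpath : ∀ i j, 2 ≤ Fintype.card (ι i) → 2 ≤ Fintype.card (ι j) →
      Joined (crossMap (h.matching i) (crossIncl (ι i) (crossCentre (ι i))))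
        (crossMap (h.matching j) (crossIncl (ι j) (crossCentre (ι j))))) :
    ∃ (x₀ : indepRest G a) (ℓ : ∀ i, C(sumZero (ι i), indepRest G a)),
      (∀ i w, simplexGauge w = 1 → h.cell i w = indepRestIncl G a (ℓ i w)) ∧
      ∀ i w, 2 ≤ simplexGauge w → ℓ i w = x₀ := by
  classical
  -- A facet boundary bounds the rest of its cross-polytope, which contracts to the opposite centre.
  -- The retraction `r` moves this contraction into `indepRest`, and a path of the independence
  -- complex between opposite centres to a path that connects the resulting constants.
  obtain ⟨r, hr⟩ := h.exists_retraction
  let q : ∀ i, G.indepSpace := fun i =>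
    crossMap (h.matching i) (crossIncl (ι i) (crossCentre (ι i)))
  obtain ⟨x₀, hx₀⟩ : ∃ x₀, ∀ i, 2 ≤ Fintype.card (ι i) → Joined (r (q i)) x₀ := by
    by_cases hi : ∃ i, 2 ≤ Fintype.card (ι i)
    · obtain ⟨i, hi⟩ := hi
      exact ⟨r (q i), fun j hj => ((hpath j i hj hi).map r.continuous)⟩
    · push Not at hi
      exact ⟨r ⟨_, G.single_mem_indepSpace (Classical.arbitrary V)⟩,
        fun i hi' => absurd hi' (hi i).not_ge⟩
  have ex : ∀ i, ∃ ℓ : C(sumZero (ι i), indepRest G a),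
      (∀ w, simplexGauge w = 1 → h.cell i w = indepRestIncl G a (ℓ w)) ∧
      ∀ w, 2 ≤ simplexGauge w → ℓ w = x₀ := by
    intro i
    by_cases hi : 2 ≤ Fintype.card (ι i)
    · obtain ⟨γ⟩ := hx₀ i hi
      have hg := isGauge_simplexGauge (ι := ι i)
      have hgc := hg.continuous
      have agree : ∀ w : sumZero (ι i), simplexGauge w = 3 / 2 →
          r (crossMap (h.matching i) (crossIncl (ι i)
            (crossAttach (max 1 (2 * simplexGauge w - 1) • w)))) =
          γ.extend (2 * simplexGauge w - 3) := by
        intro w hw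
        rw [crossAttach_of_two_le, hw]
        · norm_num
          rfl
        · rw [hg.map_smul _ _ (by positivity), hw]
          norm_num
      refine ⟨⟨fun w => if simplexGauge w ≤ 3 / 2 then
          r (crossMap (h.matching i) (crossIncl (ι i)
            (crossAttach (max 1 (2 * simplexGauge w - 1) • w)))) else
          γ.extend (2 * simplexGauge w - 3), continuous_if_le hgc continuous_const
          (Continuous.continuousOn (by fun_prop)) (Continuous.continuousOn ?_) agree⟩,
        fun w hw => ?_, fun w hw => ?_⟩
      · exact γ.continuous_extend.comp (by fun_prop)
      · have h1 : simplexGauge w ≤ 3 / 2 := by rw [hw]; norm_num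
        change _ = indepRestIncl G a (if _ then _ else _)
        rw [if_pos h1, hw]
        norm_num
        rw [crossIncl_crossAttach hw]
        exact Subtype.ext (congrArg Subtype.val (hr _ (h.cell_mem_indepRest hw))).symm
      · have h1 : ¬ simplexGauge w ≤ 3 / 2 := by intro h2; linarith
        change (if _ then _ else _) = x₀
        rw [if_neg h1]
        exact γ.extend_of_one_le (by linarith)
    · -- For a single edge the cell is a point, so that its boundary is empty.
      have hlt : ∀ w : sumZero (ι i), ¬ 1 ≤ simplexGauge w := by
        intro w hw
        have : Subsingleton (ι i) := Fintype.card_le_one_iff_subsingleton.mp (by omega)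
        obtain ⟨e, he⟩ := one_le_simplexGauge.mp hw
        have h1 := sum_addBarycentre w
        rw [Fintype.sum_subsingleton _ e] at h1
        linarith
      exact ⟨ContinuousMap.const _ x₀, fun w hw => (hlt w hw.ge).elim,
        fun w hw => (hlt w (by linarith)).elim⟩
  choose ℓ h1 h2 using ex
  exact ⟨x₀, ℓ, h1, h2⟩

/-- The splitting, with any spheres in place of the cross-polytopes and arbitrary base points. -/
theorem nonempty_homotopyEquiv_wedge {x₀ : indepRest G a}
    {ℓ : ∀ i, C(sumZero (ι i), indepRest G a)}
    (hℓ : ∀ i w, simplexGauge w = 1 → h.cell i w = indepRestIncl G a (ℓ i w))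
    (hx₀ : ∀ i w, 2 ≤ simplexGauge w → ℓ i w = x₀) {Z : Fin k → Type*}
    [∀ i, TopologicalSpace (Z i)] (e : ∀ i, Z i ≃ₜ UnitSphere (Fintype.card (ι i)))
    (z : ∀ i, Z i) :
    Nonempty (G.indepSpace ≃ₕ Wedge (IndexedWedge.base Z z) x₀) := by
  choose f hf using fun i =>
    exists_crossPolytope_homeomorph (e i) (crossIncl (ι i) (crossCentre (ι i))) (z i)
  have := (h.isCellAttachment hℓ).nonempty_homotopyEquiv_wedge
    (fun i => isGauge_simplexGauge) hx₀
    (fun i => (isCellAttachment_crossPolytope (ι := ι i)).comp_homeomorph (f i))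
    (p := fun i => crossCentre (ι i)) (fun i => crossContract) (fun _ => crossContract_zero)
    (fun _ d _ ht => crossContract_of_one_le d ht) (fun _ => crossContract_centre)
    (fun i w τ hw hτ => by rw [crossAttach_smul hw hτ, crossAttach_of_eq_one hw])
  have hz : z = fun i => ((f i : C(_, _)).comp (crossIncl (ι i))) (crossCentre (ι i)) :=
    funext fun i => (hf i).symm
  rw [hz]
  exact this

end IsMatchingSequence

end Splitting

/-! ### Induced matchings as subgraphs -/

section Subgraphs

variable {V : Type*} {G : SimpleGraph V}

/-- The edges of an induced matching with a dominating transversal, indexed by themselves: `a e` is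
the end of `e` in the transversal and `b e` is the other one. -/
theorem SimpleGraph.Subgraph.IsInducedMatching.exists_indexing {M : G.Subgraph}
    (hM : M.IsInducedMatching) {σ : Set V} (hσ : M.IsDominatingTransversal σ) :
    ∃ a b : M.edgeSet → V, IsIndexedMatching G a b ∧ (∀ e, M.Adj (a e) (b e)) ∧
      (∀ v, v ∈ σ ↔ ∃ e, v = a e) ∧ ∀ v ∈ M.verts, (∃ e, v = a e) ∨ ∃ e, v = b e := by
  choose a ha hau using fun e : M.edgeSet => hσ.existsUnique e.1 e.2
  choose b hb using fun e : M.edgeSet => (ha e).2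
  have hadj : ∀ e, M.Adj (a e) (b e) := fun e => by
    have := e.2
    rwa [hb e, SimpleGraph.Subgraph.mem_edgeSet] at this
  have huniq : ∀ {x y z}, M.Adj x y → M.Adj x z → y = z := fun {x y z} h1 h2 =>
    (hM.1 (M.edge_vert h1)).unique h1 h2
  have hnot : ∀ e, b e ∉ σ := fun e he => by
    have h1 : b e = a e := hau e _ ⟨he, by rw [hb e]; exact Sym2.mem_mk_right _ _⟩
    exact (hadj e).ne h1.symm
  have hind : ∀ {x y}, x ∈ M.verts → y ∈ M.verts → G.Adj x y → M.Adj x y :=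
    fun {x y} hx hy h => hM.2 hx hy h
  have hav : ∀ e, a e ∈ M.verts := fun e => M.edge_vert (hadj e)
  have hbv : ∀ e, b e ∈ M.verts := fun e => M.edge_vert (hadj e).symm
  have hmem : ∀ v, v ∈ σ ↔ ∃ e, v = a e := fun v => by
    refine ⟨fun hv => ?_, ?_⟩
    · obtain ⟨w, hw, -⟩ := hM.1 (hσ.subset_verts hv)
      exact ⟨⟨s(v, w), hw⟩, hau ⟨s(v, w), hw⟩ v ⟨hv, Sym2.mem_mk_left _ _⟩⟩
    · rintro ⟨e, rfl⟩
      exact (ha e).1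
  refine ⟨a, b, ⟨fun e e' => ⟨fun h => ?_, ?_⟩, fun e e' h => ?_, fun e e' h => ?_⟩, hadj, hmem,
    fun v hv => ?_⟩
  · have h1 : b e' = b e := huniq (hind (hav e) (hbv e') h) (hadj e)
    have h2 : a e' = a e := huniq (h1 ▸ (hadj e').symm) (hadj e).symm
    exact Subtype.ext (by rw [hb e, hb e', h1, h2])
  · rintro rfl
    exact (hadj e).adj_sub
  · have h1 := hind (hav e) (hav e') h
    exact h.ne ((hσ.existsUnique s(a e, a e') h1).unique
      ⟨(ha e).1, Sym2.mem_mk_left _ _⟩ ⟨(ha e').1, Sym2.mem_mk_right _ _⟩)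
  · have h1 := hind (hbv e) (hbv e') h
    obtain ⟨v, ⟨hv, hv'⟩, -⟩ := hσ.existsUnique s(b e, b e') h1
    rcases Sym2.mem_iff.mp hv' with rfl | rfl
    · exact hnot _ hv
    · exact hnot _ hv
  · obtain ⟨w, hw, -⟩ := hM.1 hv
    have h1 : (⟨s(v, w), hw⟩ : M.edgeSet).1 = s(v, w) := rfl
    rw [hb] at h1
    rcases Sym2.eq_iff.mp h1 with ⟨h2, -⟩ | ⟨-, h2⟩
    · exact Or.inl ⟨_, h2.symm⟩
    · exact Or.inr ⟨_, h2.symm⟩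

/-- Spheres of equal dimension are homeomorphic. -/
def unitSphereCongr {m n : ℕ} (h : m = n) : UnitSphere m ≃ₜ UnitSphere n :=
  h ▸ Homeomorph.refl _

/-- The independence complex splits off the spheres of a sequence of induced matchings with
dominating transversals. -/
theorem indepSpace_splitting {V : Type u} [Finite V] [Nonempty V] (G : SimpleGraph V) (k : ℕ)
    (M : Fin k → G.Subgraph) (σ : Fin k → Set V) (hM : ∀ i, (M i).IsInducedMatching)
    (hσ : ∀ i, (M i).IsDominatingTransversal (σ i))
    (hord : ∀ i j, i < j → (σ j \ (M i).verts).Nonempty) :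
    (∀ i, 0 < (M i).edgeSet.ncard ∧
      Nonempty ((M i).coe.indepSpace ≃ₜ UnitSphere (M i).edgeSet.ncard)) ∧
    ((∀ i j, 2 ≤ (M i).edgeSet.ncard → 2 ≤ (M j).edgeSet.ncard →
        ∀ x y : G.indepSpace, (∀ v, v ∉ (M i).verts → x.1 v = 0) →
          (∀ v, v ∉ (M j).verts → y.1 v = 0) → Joined x y) →
    ∃ (X : Type u) (_ : TopologicalSpace X) (x₀ : X),
      (∀ p : ∀ i, (M i).coe.indepSpace,
        Nonempty (G.indepSpace ≃ₕ
          Wedge (IndexedWedge.base (fun i => (M i).coe.indepSpace) p) x₀)) ∧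
      (∀ p : ∀ i, UnitSphere (M i).edgeSet.ncard,
        Nonempty (G.indepSpace ≃ₕ
          Wedge (IndexedWedge.base (fun i => UnitSphere (M i).edgeSet.ncard) p) x₀))) := by
  classical
  choose a b hab hadj hmem hverts using fun i => (hM i).exists_indexing (hσ i)
  have hne : ∀ i, Nonempty (M i).edgeSet := fun i => by
    obtain ⟨v⟩ := ‹Nonempty V›
    obtain ⟨w, hw⟩ : (σ i).Nonempty :=
      ((hσ i).dominating v).elim (fun h => ⟨v, h⟩) fun ⟨w, hw, _⟩ => ⟨w, hw⟩
    exact ⟨((hmem i w).mp hw).choose⟩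
  have hfin : ∀ i, Fintype (M i).edgeSet := fun i => Fintype.ofFinite _
  have hcard : ∀ i, Fintype.card (M i).edgeSet = (M i).edgeSet.ncard := fun i =>
    Nat.card_eq_fintype_card.symm
  have hav : ∀ i e, a i e ∈ (M i).verts := fun i e => (M i).edge_vert (hadj i e)
  have hbv : ∀ i e, b i e ∈ (M i).verts := fun i e => (M i).edge_vert (hadj i e).symm
  have hseq : IsMatchingSequence G a b :=
    { matching := hab
      dominating := fun i v => ((hσ i).dominating v).imp (hmem i v).mp fun ⟨w, hw, hvw⟩ => by
        obtain ⟨e, rfl⟩ := (hmem i w).mp hw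
        exact ⟨e, hvw⟩
      exists_notMem := fun i j hij => by
        obtain ⟨v, hv, hv'⟩ := hord i j hij
        obtain ⟨e, rfl⟩ := (hmem j v).mp hv
        exact ⟨e, fun e' h => hv' (h ▸ hav i e'), fun e' h => hv' (h ▸ hbv i e')⟩ }
  have hsphere : ∀ i, Nonempty ((M i).coe.indepSpace ≃ₜ
      UnitSphere (Fintype.card (M i).edgeSet)) := fun i => by
    have h1 : IsIndexedMatching (M i).coe (fun e => ⟨a i e, hav i e⟩)
        (fun e => ⟨b i e, hbv i e⟩) :=
      { adj_iff := fun e e' => ⟨fun h => ((hab i).adj_iff e e').mp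
          (SimpleGraph.Subgraph.Adj.adj_sub h), fun h => h ▸ hadj i e⟩
        not_adj_left := fun e e' h =>
          (hab i).not_adj_left e e' (SimpleGraph.Subgraph.Adj.adj_sub h)
        not_adj_right := fun e e' h =>
          (hab i).not_adj_right e e' (SimpleGraph.Subgraph.Adj.adj_sub h) }
    obtain ⟨f⟩ := nonempty_crossPolytope_homeomorph_indepSpace h1 fun x =>
      (hverts i x.1 x.2).imp (fun ⟨e, he⟩ => ⟨e, Subtype.ext he⟩)
        fun ⟨e, he⟩ => ⟨e, Subtype.ext he⟩
    exact ⟨f.symm.trans (crossPolytopeHomeomorph _)⟩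
  let f := fun i => (hsphere i).some
  refine ⟨fun i => ⟨hcard i ▸ Fintype.card_pos, ⟨(f i).trans (unitSphereCongr (hcard i))⟩⟩,
    fun hpath => ?_⟩
  obtain ⟨x₀, ℓ, hℓ, hx₀⟩ := hseq.exists_attaching fun i j hi hj => by
    have hsupp : ∀ i v w, w ∉ (M i).verts → crossVector (a i) (b i) v w = 0 :=
      fun i v w hw => crossVector_of_notMem _ (fun e h => hw (h ▸ hav i e))
        fun e h => hw (h ▸ hbv i e)
    exact hpath i j (hcard i ▸ hi) (hcard j ▸ hj) _ _ (hsupp i _) (hsupp j _)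
  exact ⟨indepRest G a, inferInstance, x₀,
    fun p => hseq.nonempty_homotopyEquiv_wedge hℓ hx₀ f p,
    fun p => hseq.nonempty_homotopyEquiv_wedge hℓ hx₀ (fun i => unitSphereCongr (hcard i).symm) p⟩

end Subgraphs

/-! ### Large hexagons -/

section Hexagon

/-- The period lattice of the tiling by large hexagons, described by congruences. -/
def tileLattice : AddSubgroup (ℤ × ℤ) where
  carrier := {d | 4 ∣ d.2 ∧ 12 ∣ d.1 - d.2}
  add_mem' {a b} ha hb := by
    simp only [Set.mem_ofPred_eq, Prod.fst_add, Prod.snd_add] at *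
    omega
  zero_mem' := by simp
  neg_mem' {a} ha := by
    simp only [Set.mem_ofPred_eq, Prod.fst_neg, Prod.snd_neg] at *
    omega

theorem mem_tileLattice {d : ℤ × ℤ} : d ∈ tileLattice ↔ 4 ∣ d.2 ∧ 12 ∣ d.1 - d.2 := Iff.rfl

instance : DecidablePred (· ∈ tileLattice) := fun d =>
  inferInstanceAs (Decidable (4 ∣ d.2 ∧ 12 ∣ d.1 - d.2))

instance : DecidablePred (· ∈ triangularUnits) := fun d =>
  inferInstanceAs (Decidable (d = (1, 0) ∨ d = (-1, 0) ∨ d = (0, 1) ∨ d = (0, -1) ∨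
    d = (1, -1) ∨ d = (-1, 1)))

/-- Eight edges of the large hexagon centred at the origin that form an induced matching. The first
ends form a transversal. The choice of `s` affects only the last two edges. -/
def hexagonEdge (s : Bool) : Fin 8 → (ℤ × ℤ) × (ℤ × ℤ) :=
  ![((-3, 2), (-3, 3)), ((-2, -1), (-3, 0)), ((-1, 3), (0, 3)), ((1, -3), (0, -3)),
    ((2, 1), (3, 0)), ((3, -2), (3, -3)),
    cond s ((-1, 0), (-1, 1)) ((0, -1), (1, -1)), cond s ((1, 0), (1, -1)) ((0, 1), (-1, 1))]

/-- The vertices of the matchings `hexagonEdge`. -/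
def hexagonOffsets : List (ℤ × ℤ) :=
  [(-3, 2), (-3, 3), (-2, -1), (-3, 0), (-1, 3), (0, 3), (1, -3), (0, -3), (2, 1), (3, 0), (3, -2),
    (3, -3), (-1, 0), (-1, 1), (0, -1), (1, -1), (1, 0), (0, 1)]

theorem hexagonEdge_mem : ∀ s e, (hexagonEdge s e).1 ∈ hexagonOffsets ∧
    (hexagonEdge s e).2 ∈ hexagonOffsets := by
  decide +kernel

theorem hexagonOffsets_not_even : ∀ α ∈ hexagonOffsets, ¬ (Even α.1 ∧ Even α.2) := by
  decide +kernel

/-- Different vertices of the matchings are inequivalent under `tileLattice`. -/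
theorem hexagonOffsets_separated : ∀ α ∈ hexagonOffsets, ∀ β ∈ hexagonOffsets,
    α - β ∈ tileLattice → α = β := by
  decide +kernel

/-- There are no edges between the matchings in different large hexagons. -/
theorem hexagonOffsets_not_adj : ∀ α ∈ hexagonOffsets, ∀ β ∈ hexagonOffsets,
    ∀ δ ∈ [((1, 0) : ℤ × ℤ), (-1, 0), (0, 1), (0, -1), (1, -1), (-1, 1)],
      δ - (β - α) ∈ tileLattice → δ = β - α := by
  decide +kernel

theorem hexagonEdge_induced : ∀ s e e',
    ((hexagonEdge s e').2 - (hexagonEdge s e).1 ∈ triangularUnits ↔ e = e') ∧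
    (hexagonEdge s e').1 - (hexagonEdge s e).1 ∉ triangularUnits ∧
    (hexagonEdge s e').2 - (hexagonEdge s e).2 ∉ triangularUnits := by
  decide +kernel

/-- Every vertex of the lattice, here represented modulo `tileLattice`, is dominated by one large
hexagon for both choices of the transversal. For the vertices outside of the large hexagons this
holds because their dominating neighbours lie on one of the first six edges. -/
theorem hexagonEdge_dominating : ∀ k ∈ Finset.range 12, ∀ l ∈ Finset.range 4,
    ¬ (Even (k + l) ∧ Even l) →
    ∃ x ∈ [((0, 0) : ℤ × ℤ), (12, 0), (16, 4), (4, 4), (8, -4)],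
      x ∈ tileLattice ∧ ∀ s, ∃ e,
        x + (hexagonEdge s e).1 - ((k : ℤ) + l, (l : ℤ)) = 0 ∨
        x + (hexagonEdge s e).1 - ((k : ℤ) + l, (l : ℤ)) ∈ triangularUnits := by
  decide +kernel

/-- The two choices are distinguished by the vertex `(-1, 0)`, which occurs only for `s = true` as a
first end. -/
theorem hexagonEdge_true_ne : ∀ e, (hexagonEdge false e).1 ≠ (hexagonEdge true 6).1 ∧
    (hexagonEdge false e).2 ≠ (hexagonEdge true 6).1 := by
  decide +kernel

theorem triangularUnits_notMem_tileLattice {d : ℤ × ℤ} (hd : d ∈ triangularUnits) :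
    d ∉ tileLattice := by
  rw [mem_tileLattice]
  rcases hd with rfl | rfl | rfl | rfl | rfl | rfl <;> decide

/-- Translations that preserve a tiling preserve it for every choice of the centre `c`. -/
theorem isTiledKagome_iff {L : AddSubgroup (ℤ × ℤ)} : IsTiledKagome L ↔ L ≤ tileLattice := by
  constructor
  · rintro ⟨c, -, -, h⟩ l hl
    obtain ⟨i, j, hij⟩ := h l hl c ⟨0, 0, by simp⟩
    have h1 : l = i • ((4, 4) : ℤ × ℤ) + j • ((8, -4) : ℤ × ℤ) := by
      rw [add_assoc] at hij
      exact add_left_cancel hij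
    rw [mem_tileLattice, h1]
    simp only [Prod.fst_add, Prod.snd_add, Prod.smul_fst, Prod.smul_snd, smul_eq_mul]
    omega
  · refine fun h => ⟨(1, 1), odd_one, odd_one, ?_⟩
    rintro l hl _ ⟨i, j, rfl⟩
    obtain ⟨⟨y, hy⟩, ⟨z, hz⟩⟩ := mem_tileLattice.mp (h hl)
    refine ⟨i + y + z, j + z, ?_⟩
    ext <;> simp <;> linarith

end Hexagon

/-! ### Path connectedness of independence complexes -/

section Connected

theorem SimpleGraph.joined_indepSpace_of_support {V : Type*} [Finite V] {G : SimpleGraph V}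
    (x y : G.indepSpace)
    (h : ∀ u v, G.Adj u v → (x.1 u = 0 ∧ y.1 u = 0) ∨ (x.1 v = 0 ∧ y.1 v = 0)) :
    Joined x y := by
  have := Fintype.ofFinite V
  have hseg : segment ℝ x.1 y.1 ⊆ G.indepSpace := by
    rintro _ ⟨s, t, hs, ht, hst, rfl⟩
    refine mem_indepSpace.mpr ⟨fun v => ?_, ?_, fun u v huv => ?_⟩
    · exact add_nonneg (mul_nonneg hs (x.2.1 v)) (mul_nonneg ht (y.2.1 v))
    · simp [Finset.sum_add_distrib, ← Finset.mul_sum, sum_indepSpace, hst]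
    · exact (h u v huv).imp (fun h => by simp [h.1, h.2]) fun h => by simp [h.1, h.2]
  exact (joinedIn_iff_joined x.2 y.2).mp (JoinedIn.of_segment_subset hseg)

/-- If no two vertices dominate the graph, then its independence complex is path connected. -/
theorem SimpleGraph.joined_indepSpace {V : Type*} [Finite V] {G : SimpleGraph V}
    (h : ∀ u v, ∃ w, ¬ G.Adj u w ∧ ¬ G.Adj v w) (x y : G.indepSpace) : Joined x y := by
  classical
  have := Fintype.ofFinite V
  let δ : V → G.indepSpace := fun v => ⟨Pi.single v 1, G.single_mem_indepSpace v⟩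
  have hδ : ∀ {u v}, u ≠ v → (δ v).1 u = 0 := fun {u v} h => Pi.single_eq_of_ne h _
  have hvert : ∀ u v, ¬ G.Adj u v → Joined (δ u) (δ v) := fun u v huv => by
    refine joined_indepSpace_of_support _ _ fun a b hab => ?_
    by_cases ha : a ≠ u ∧ a ≠ v
    · exact Or.inl ⟨hδ ha.1, hδ ha.2⟩
    by_cases hb : b ≠ u ∧ b ≠ v
    · exact Or.inr ⟨hδ hb.1, hδ hb.2⟩
    have h1 := hab.symm
    grind [hab.ne]
  have hx : ∀ x : G.indepSpace, ∃ v, Joined x (δ v) := fun x => by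
    obtain ⟨v, hv⟩ : ∃ v, x.1 v ≠ 0 := by
      by_contra! h0
      have := sum_indepSpace x
      simp [h0] at this
    refine ⟨v, joined_indepSpace_of_support _ _ fun a b hab => ?_⟩
    rcases eq_zero_or_of_adj x hab with h1 | h1
    · exact Or.inl ⟨h1, hδ fun h2 => hv (h2 ▸ h1)⟩
    · exact Or.inr ⟨h1, hδ fun h2 => hv (h2 ▸ h1)⟩
  obtain ⟨u, hu⟩ := hx x
  obtain ⟨v, hv⟩ := hx y
  obtain ⟨w, huw, hvw⟩ := h u v
  exact hu.trans ((hvert u w huw).trans ((hvert v w hvw).symm.trans hv.symm))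

end Connected

/-! ### Finite quotients of the Kagome lattice -/

section Kagome

/-- The vertex of the Kagome lattice at position `d` relative to the hole `(1, 1)`. -/
def kagomeVertexAt (d : ℤ × ℤ) (hd : ¬ (Even d.1 ∧ Even d.2)) : KagomeVertex :=
  ⟨(1, 1) + d, by simpa [parity_simps] using hd⟩

variable {L : AddSubgroup (ℤ × ℤ)}

theorem kagomeVertexAt_surjective (p : KagomeVertex) :
    ∃ d hd, p = kagomeVertexAt d hd := by
  refine ⟨p.1 - (1, 1), ?_, Subtype.ext (by simp [kagomeVertexAt])⟩
  simpa [parity_simps] using p.2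

theorem mk_kagomeVertexAt_eq_iff {d d' : ℤ × ℤ} (hd hd') :
    Quotient.mk (kagomeSetoid L) (kagomeVertexAt d hd) =
      Quotient.mk (kagomeSetoid L) (kagomeVertexAt d' hd') ↔ d' - d ∈ L := by
  rw [Quotient.eq]
  change ((1, 1) + d') - ((1, 1) + d) ∈ L ↔ _
  rw [add_sub_add_left_eq_sub]

theorem adj_mk_kagomeVertexAt_iff (hL : L ≤ tileLattice) {d d' : ℤ × ℤ} (hd hd') :
    (kagomeQuotientGraph L).Adj (Quotient.mk _ (kagomeVertexAt d hd))
      (Quotient.mk _ (kagomeVertexAt d' hd')) ↔ ∃ δ ∈ triangularUnits, δ - (d' - d) ∈ L := by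
  constructor
  · rintro ⟨-, p, q, hp, hq, h⟩
    have h1 : d - (p.1 - (1, 1)) ∈ L := by
      have h0 : (1, 1) + d - p.1 ∈ L := Quotient.exact hp
      rwa [sub_sub_eq_add_sub, add_comm d]
    have h2 : d' - (q.1 - (1, 1)) ∈ L := by
      have h0 : (1, 1) + d' - q.1 ∈ L := Quotient.exact hq
      rwa [sub_sub_eq_add_sub, add_comm d']
    refine ⟨q.1 - p.1, h, ?_⟩
    convert L.sub_mem h1 h2 using 1
    abel
  · rintro ⟨δ, hδ, h⟩
    have hv : ¬ (Even (d + δ).1 ∧ Even (d + δ).2) := by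
      obtain ⟨h1, h2⟩ := mem_tileLattice.mp (hL h)
      simp only [Prod.fst_sub, Prod.snd_sub, Prod.fst_add, Prod.snd_add, Int.even_iff] at *
      omega
    refine ⟨fun he => ?_, kagomeVertexAt d hd, kagomeVertexAt (d + δ) hv, rfl, ?_, ?_⟩
    · rw [mk_kagomeVertexAt_eq_iff] at he
      refine triangularUnits_notMem_tileLattice hδ (hL ?_)
      simpa using L.add_mem h he
    · rw [mk_kagomeVertexAt_eq_iff, ← neg_mem_iff]
      convert h using 1
      abel
    · change (1, 1) + (d + δ) - ((1, 1) + d) ∈ triangularUnits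
      simpa [add_sub_add_left_eq_sub] using hδ

variable (L) in
/-- The large hexagons in the quotient by `L`. -/
abbrev Tile : Type := tileLattice ⧸ L.addSubgroupOf tileLattice

/-- The centre of a chosen large hexagon over a large hexagon of the quotient, relative to the
hole `(1, 1)`. -/
noncomputable def Tile.centre (q : Tile L) : ℤ × ℤ := (Quotient.out q : tileLattice).1

theorem Tile.centre_mem (q : Tile L) : q.centre ∈ tileLattice := (Quotient.out q : tileLattice).2

theorem Tile.exists_centre {x : ℤ × ℤ} (hx : x ∈ tileLattice) : ∃ q : Tile L, x - q.centre ∈ L := by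
  refine ⟨QuotientAddGroup.mk ⟨x, hx⟩, ?_⟩
  have h : (QuotientAddGroup.mk (Quotient.out (QuotientAddGroup.mk ⟨x, hx⟩ : Tile L)) : Tile L) =
    QuotientAddGroup.mk ⟨x, hx⟩ := Quotient.out_eq' _
  have := QuotientAddGroup.eq.mp h
  rw [AddSubgroup.mem_addSubgroupOf] at this
  convert this using 1
  change _ = -_ + x
  rw [neg_add_eq_sub]
  rfl

theorem Tile.eq_of_sub_mem {q q' : Tile L} (h : q'.centre - q.centre ∈ L) : q = q' := by
  rw [← Quotient.out_eq' q, ← Quotient.out_eq' q']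
  refine QuotientAddGroup.eq.mpr ?_
  rw [AddSubgroup.mem_addSubgroupOf]
  convert h using 1
  change -_ + _ = _
  rw [neg_add_eq_sub]
  rfl

/-- Translation by `tileLattice` preserves the parity of coordinates. -/
theorem not_even_add {x d : ℤ × ℤ} (hx : x ∈ tileLattice) (hd : ¬ (Even d.1 ∧ Even d.2)) :
    ¬ (Even (x + d).1 ∧ Even (x + d).2) := by
  obtain ⟨h1, h2⟩ := mem_tileLattice.mp hx
  simp only [Prod.fst_add, Prod.snd_add, Int.even_iff] at *
  omega

/-- The vertex with offset `d` from the centre of a large hexagon of the quotient. -/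
noncomputable def Tile.vertex (q : Tile L) (d : ℤ × ℤ) (hd : ¬ (Even d.1 ∧ Even d.2)) :
    KagomeQuotient L :=
  Quotient.mk _ (kagomeVertexAt (q.centre + d) (not_even_add q.centre_mem hd))

/-- Representatives of the vertices of the Kagome lattice modulo `tileLattice`. -/
abbrev TileResidue : Type := {r : Fin 12 × Fin 4 // ¬ (Even (r.1.1 + r.2.1) ∧ Even r.2.1)}

/-- A residue as a position relative to the hole `(1, 1)`. -/
def TileResidue.offset (r : TileResidue) : ℤ × ℤ := ((r.1.1.1 : ℤ) + r.1.2.1, (r.1.2.1 : ℤ))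

theorem TileResidue.offset_not_even (r : TileResidue) : ¬ (Even r.offset.1 ∧ Even r.offset.2) := by
  have := r.2
  simp only [TileResidue.offset, Int.even_iff, Nat.even_iff] at *
  omega

theorem TileResidue.exists_offset {d : ℤ × ℤ} (hd : ¬ (Even d.1 ∧ Even d.2)) :
    ∃ r : TileResidue, d - r.offset ∈ tileLattice := by
  obtain ⟨k, hk⟩ := Int.eq_ofNat_of_zero_le
    (Int.emod_nonneg (d.1 - d.2) (by norm_num : (12 : ℤ) ≠ 0))
  obtain ⟨l, hl⟩ := Int.eq_ofNat_of_zero_le (Int.emod_nonneg d.2 (by norm_num : (4 : ℤ) ≠ 0))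
  refine ⟨⟨(⟨k, by omega⟩, ⟨l, by omega⟩), ?_⟩, ?_⟩
  · simp only [Int.even_iff, Nat.even_iff] at *
    omega
  · rw [mem_tileLattice]
    simp only [TileResidue.offset, Prod.fst_sub, Prod.snd_sub]
    omega

theorem TileResidue.eq_of_sub_mem {r r' : TileResidue} (h : r'.offset - r.offset ∈ tileLattice) :
    r = r' := by
  obtain ⟨⟨⟨k, hk⟩, ⟨l, hl⟩⟩, hr⟩ := r
  obtain ⟨⟨⟨k', hk'⟩, ⟨l', hl'⟩⟩, hr'⟩ := r'
  rw [mem_tileLattice] at h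
  simp only [TileResidue.offset, Prod.fst_sub, Prod.snd_sub] at h
  simp only [Subtype.mk.injEq, Prod.mk.injEq, Fin.mk.injEq]
  omega

theorem card_tileResidue : Fintype.card TileResidue = 36 := by
  decide +kernel

/-- The quotient consists of one copy of the 36 residues for each large hexagon. -/
theorem tile_bijective (hL : L ≤ tileLattice) : Function.Bijective
    (fun x : Tile L × TileResidue => x.1.vertex x.2.offset x.2.offset_not_even) := by
  constructor
  · rintro ⟨q, r⟩ ⟨q', r'⟩ h
    have h1 := (mk_kagomeVertexAt_eq_iff _ _).mp h
    have h2 : r = r' := by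
      refine TileResidue.eq_of_sub_mem ?_
      have := tileLattice.sub_mem (hL h1) (tileLattice.sub_mem q'.centre_mem q.centre_mem)
      convert this using 1
      abel
    subst h2
    rw [add_sub_add_right_eq_sub] at h1
    exact Prod.ext (Tile.eq_of_sub_mem h1) rfl
  · intro v
    induction v using Quotient.inductionOn with
    | h p =>
      obtain ⟨d, hd, rfl⟩ := kagomeVertexAt_surjective p
      obtain ⟨r, hr⟩ := TileResidue.exists_offset hd
      obtain ⟨q, hq⟩ := Tile.exists_centre (L := L) hr
      refine ⟨(q, r), (mk_kagomeVertexAt_eq_iff _ _).mpr ?_⟩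
      convert hq using 1
      dsimp only
      abel

theorem finite_tile [Finite (KagomeQuotient L)] (hL : L ≤ tileLattice) : Finite (Tile L) := by
  have h := Finite.of_injective _ (tile_bijective hL).injective
  exact Finite.of_injective (fun q : Tile L => (q, (⟨(1, 0), by decide⟩ : TileResidue)))
    fun q q' h => congrArg Prod.fst h

theorem card_kagomeQuotient (hL : L ≤ tileLattice) :
    Nat.card (KagomeQuotient L) = 36 * Nat.card (Tile L) := by
  rw [← Nat.card_eq_of_bijective _ (tile_bijective hL), Nat.card_prod,
    Nat.card_eq_fintype_card (α := TileResidue), card_tileResidue, mul_comm]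

/-- A vertex has at most six neighbours, hence two vertices do not dominate the quotient. -/
theorem exists_not_adj_kagomeQuotient [Finite (KagomeQuotient L)] (hL : L ≤ tileLattice)
    (u v : KagomeQuotient L) :
    ∃ w, ¬ (kagomeQuotientGraph L).Adj u w ∧ ¬ (kagomeQuotientGraph L).Adj v w := by
  classical
  -- The value of `f` at a unit vector that leads out of the lattice is irrelevant.
  have hnb : ∀ u : KagomeQuotient L, ∃ f : triangularUnits → KagomeQuotient L,
      ∀ w, (kagomeQuotientGraph L).Adj u w → ∃ δ, f δ = w := by
    intro u
    induction u using Quotient.inductionOn with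
    | h p =>
      obtain ⟨d, hd, rfl⟩ := kagomeVertexAt_surjective p
      refine ⟨fun δ => if h : ¬ (Even (d + δ.1).1 ∧ Even (d + δ.1).2) then
        Quotient.mk _ (kagomeVertexAt (d + δ.1) h) else Quotient.mk _ (kagomeVertexAt d hd),
        fun w hw => ?_⟩
      induction w using Quotient.inductionOn with
      | h p' =>
        obtain ⟨d', hd', rfl⟩ := kagomeVertexAt_surjective p'
        obtain ⟨δ, hδ, h⟩ := (adj_mk_kagomeVertexAt_iff hL hd hd').mp hw
        have he : d' - (d + δ) ∈ L := by
          rw [← neg_mem_iff]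
          convert h using 1
          abel
        have hv : ¬ (Even (d + δ).1 ∧ Even (d + δ).2) := by
          have h0 := not_even_add (tileLattice.neg_mem (hL he)) hd'
          have h1 : -(d' - (d + δ)) + d' = d + δ := by abel
          rwa [h1] at h0
        refine ⟨⟨δ, hδ⟩, ?_⟩
        refine (dif_pos hv).trans ?_
        exact (mk_kagomeVertexAt_eq_iff _ _).mpr he
  by_contra! hall
  obtain ⟨f, hf⟩ := hnb u
  obtain ⟨f', hf'⟩ := hnb v
  have hsurj : Function.Surjective (Sum.elim f f') := fun w => by
    by_cases hw : (kagomeQuotientGraph L).Adj u w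
    · obtain ⟨δ, hδ⟩ := hf w hw
      exact ⟨Sum.inl δ, hδ⟩
    · obtain ⟨δ, hδ⟩ := hf' w (hall w hw)
      exact ⟨Sum.inr δ, hδ⟩
  have hU : triangularUnits = (([(1, 0), (-1, 0), (0, 1), (0, -1), (1, -1), (-1, 1)] :
      List (ℤ × ℤ)).toFinset : Set (ℤ × ℤ)) := by
    ext d
    simp [triangularUnits]
  have hfin : Finite triangularUnits := by
    rw [hU]
    infer_instance
  have hcard : Nat.card triangularUnits ≤ 6 := by
    rw [hU, Nat.card_coe_set_eq, Set.ncard_coe_finset]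
    exact List.toFinset_card_le _
  have h1 := Nat.card_le_card_of_surjective _ hsurj
  rw [Nat.card_sum, card_kagomeQuotient hL] at h1
  have h2 := finite_tile hL
  have h3 : 0 < Nat.card (Tile L) := Nat.card_pos
  omega

/-- Choosing one of the two matchings in each large hexagon gives an induced matching. The `2 ^ t`
choices are listed by the binary digits of `i`, since for `i < j` some digit is `0` for `i` and
`1` for `j`, which the vertex `(-1, 0)` of the corresponding hexagon detects. -/
theorem isMatchingSequence_kagome (hL : L ≤ tileLattice) {t : ℕ} (n : Tile L ≃ Fin t) :
    IsMatchingSequence (kagomeQuotientGraph L) (k := 2 ^ t) (ι := fun _ => Tile L × Fin 8)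
      (fun i x => x.1.vertex (hexagonEdge (i.1.testBit (n x.1)) x.2).1
        (hexagonOffsets_not_even _ (hexagonEdge_mem _ _).1))
      (fun i x => x.1.vertex (hexagonEdge (i.1.testBit (n x.1)) x.2).2
        (hexagonOffsets_not_even _ (hexagonEdge_mem _ _).2)) := by
  have adj : ∀ (q q' : Tile L) (α β : ℤ × ℤ) (hα : α ∈ hexagonOffsets) (hβ : β ∈ hexagonOffsets),
      (kagomeQuotientGraph L).Adj (q.vertex α (hexagonOffsets_not_even α hα))
        (q'.vertex β (hexagonOffsets_not_even β hβ)) ↔ q = q' ∧ β - α ∈ triangularUnits := by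
    intro q q' α β hα hβ
    refine (adj_mk_kagomeVertexAt_iff hL _ _).trans ⟨?_, ?_⟩
    · rintro ⟨δ, hδ, h⟩
      have hT := tileLattice.add_mem (hL h) (tileLattice.sub_mem q'.centre_mem q.centre_mem)
      have h1 : δ = β - α := by
        refine hexagonOffsets_not_adj α hα β hβ δ (by simpa [triangularUnits] using hδ) ?_
        convert hT using 1
        abel
      refine ⟨(Tile.eq_of_sub_mem ?_).symm, h1 ▸ hδ⟩
      rw [h1] at h
      convert h using 1
      abel
    · rintro ⟨rfl, h⟩
      refine ⟨β - α, h, ?_⟩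
      rw [add_sub_add_left_eq_sub, sub_self]
      exact L.zero_mem
  refine ⟨fun i => ⟨?_, ?_, ?_⟩, fun i v => ?_, fun i j hij => ?_⟩
  · rintro ⟨q, e⟩ ⟨q', e'⟩
    rw [adj _ _ _ _ (hexagonEdge_mem _ _).1 (hexagonEdge_mem _ _).2, Prod.mk.injEq]
    refine and_congr_right fun h => ?_
    subst h
    exact (hexagonEdge_induced _ e e').1
  · rintro ⟨q, e⟩ ⟨q', e'⟩
    rw [adj _ _ _ _ (hexagonEdge_mem _ _).1 (hexagonEdge_mem _ _).1]
    rintro ⟨rfl, h⟩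
    exact (hexagonEdge_induced _ e e').2.1 h
  · rintro ⟨q, e⟩ ⟨q', e'⟩
    rw [adj _ _ _ _ (hexagonEdge_mem _ _).2 (hexagonEdge_mem _ _).2]
    rintro ⟨rfl, h⟩
    exact (hexagonEdge_induced _ e e').2.2 h
  · induction v using Quotient.inductionOn with
    | h p =>
      obtain ⟨d, hd, rfl⟩ := kagomeVertexAt_surjective p
      obtain ⟨r, hr⟩ := TileResidue.exists_offset hd
      obtain ⟨x, -, hx, hdom⟩ := hexagonEdge_dominating r.1.1 (by simp) r.1.2 (by simp) r.2
      obtain ⟨q, hq⟩ := Tile.exists_centre (L := L) (tileLattice.add_mem hr hx)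
      obtain ⟨e, he⟩ := hdom (i.1.testBit (n q))
      have hcongr : ∀ α : ℤ × ℤ, (x + α - r.offset) - (q.centre + α - d) ∈ L := fun α => by
        convert hq using 1
        abel
      refine he.imp (fun he => ⟨(q, e), ?_⟩) fun he => ⟨(q, e), ?_⟩
      · refine (mk_kagomeVertexAt_eq_iff _ _).mpr ?_
        have h1 := hcongr (hexagonEdge (i.1.testBit (n q)) e).1
        have he' : x + (hexagonEdge (i.1.testBit (n q)) e).1 - r.offset = 0 := he
        rw [he', zero_sub, neg_mem_iff] at h1
        exact h1
      · exact (adj_mk_kagomeVertexAt_iff hL _ _).mpr ⟨_, he, hcongr _⟩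
  · obtain ⟨m, hm1, hm2⟩ : ∃ m, j.1.testBit m = true ∧ i.1.testBit m = false := by
      by_contra! hall
      refine absurd (Nat.le_of_testBit fun m hm => ?_) (not_le.mpr hij)
      simpa using hall m hm
    have hmt : m < t := by
      by_contra! hm
      rw [Nat.testBit_lt_two_pow (j.2.trans_le (Nat.pow_le_pow_right two_pos hm))] at hm1
      exact absurd hm1 (by simp)
    have key : ∀ (q' : Tile L) (α β : ℤ × ℤ) (hα : α ∈ hexagonOffsets) (hβ : β ∈ hexagonOffsets),
        (n.symm ⟨m, hmt⟩).vertex α (hexagonOffsets_not_even α hα) =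
          q'.vertex β (hexagonOffsets_not_even β hβ) → β = α ∧ n.symm ⟨m, hmt⟩ = q' := by
      intro q' α β hα hβ h
      have h1 := (mk_kagomeVertexAt_eq_iff _ _).mp h
      have h2 : β = α := by
        refine hexagonOffsets_separated β hβ α hα ?_
        have := tileLattice.sub_mem (hL h1)
          (tileLattice.sub_mem q'.centre_mem (n.symm ⟨m, hmt⟩).centre_mem)
        convert this using 1
        abel
      refine ⟨h2, Tile.eq_of_sub_mem ?_⟩
      rwa [h2, add_sub_add_right_eq_sub] at h1
    -- The edge with index `6` of the choice `true` starts at `(-1, 0)`.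
    refine ⟨(n.symm ⟨m, hmt⟩, 6), ?_, ?_⟩
    · rintro ⟨q', e⟩ h
      obtain ⟨h1, rfl⟩ := key _ _ _ (hexagonEdge_mem _ _).1 (hexagonEdge_mem _ _).1 h
      simp only [Equiv.apply_symm_apply, hm1, hm2] at h1
      exact (hexagonEdge_true_ne e).1 h1
    · rintro ⟨q', e⟩ h
      obtain ⟨h1, rfl⟩ := key _ _ _ (hexagonEdge_mem _ _).1 (hexagonEdge_mem _ _).2 h
      simp only [Equiv.apply_symm_apply, hm1, hm2] at h1
      exact (hexagonEdge_true_ne e).2 h1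

theorem kagomeQuotient_splitting [Finite (KagomeQuotient L)] (hL : L ≤ tileLattice) :
    ∃ t : ℕ, 0 < t ∧ Nat.card (KagomeQuotient L) = 36 * t ∧
      ∃ (X : Type) (_ : TopologicalSpace X) (x₀ : X),
        ∀ p : Fin (2 ^ t) → UnitSphere (8 * t),
          Nonempty ((kagomeQuotientGraph L).indepSpace ≃ₕ
            Wedge (IndexedWedge.base (fun _ : Fin (2 ^ t) => UnitSphere (8 * t)) p) x₀) := by
  have hfin := finite_tile hL
  have hft := Fintype.ofFinite (Tile L)
  refine ⟨Nat.card (Tile L), Nat.card_pos, card_kagomeQuotient hL, ?_⟩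
  have hseq := isMatchingSequence_kagome hL (Finite.equivFin (Tile L))
  have hV : Nonempty (KagomeQuotient L) := ⟨Quotient.mk _ ⟨(0, 0), by decide⟩⟩
  obtain ⟨x₀, ℓ, hℓ, hx₀⟩ := hseq.exists_attaching fun _ _ _ _ =>
    SimpleGraph.joined_indepSpace (exists_not_adj_kagomeQuotient hL) _ _
  have hcard : 8 * Nat.card (Tile L) = Fintype.card (Tile L × Fin 8) := by
    rw [Fintype.card_prod, Fintype.card_fin, Nat.card_eq_fintype_card, mul_comm]
  exact ⟨_, inferInstance, x₀, fun p => hseq.nonempty_homotopyEquiv_wedge hℓ hx₀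
    (fun _ => unitSphereCongr hcard) p⟩

/-! ### The standard tori -/

theorem mem_kagomePeriods {n m : ℕ} {d : ℤ × ℤ} : d ∈ kagomePeriods n m ↔
    ∃ i j : ℤ, d = (2 * n * i - m * j, 2 * m * j) := by
  rw [kagomePeriods, AddSubgroup.mem_closure_pair]
  refine exists_congr fun i => exists_congr fun j => ?_
  rw [eq_comm, Prod.ext_iff, Prod.ext_iff]
  simp only [Prod.fst_add, Prod.snd_add, Prod.smul_fst, Prod.smul_snd, smul_eq_mul, mul_zero,
    zero_add]
  refine and_congr ?_ ?_
  · rw [show i * (2 * (n : ℤ)) + j * -(m : ℤ) = 2 * n * i - m * j by ring]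
  · rw [show j * (2 * (m : ℤ)) = 2 * m * j by ring]

theorem kagomePeriods_le {n m : ℕ} (hn : 6 ∣ n) (hm : 4 ∣ m) : kagomePeriods n m ≤ tileLattice := by
  intro d hd
  obtain ⟨i, j, rfl⟩ := mem_kagomePeriods.mp hd
  obtain ⟨n, rfl⟩ := hn
  obtain ⟨m, rfl⟩ := hm
  rw [mem_tileLattice]
  push_cast
  exact ⟨⟨2 * m * j, by ring⟩, ⟨n * i - m * j, by ring⟩⟩

/-- Each coset of `2ℤ × 2ℤ` other than the one formed by the holes contributes `n * m` vertices. -/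
theorem kagomePeriods_bijective {n m : ℕ} (hn : 0 < n) (hm : 0 < m) (hm2 : 2 ∣ m) :
    ∃ f : Fin 3 × Fin n × Fin m → KagomeQuotient (kagomePeriods n m), Function.Bijective f := by
  obtain ⟨l, rfl⟩ := hm2
  let c : Fin 3 → ℤ × ℤ := ![(1, 1), (1, 0), (0, 1)]
  have hc : ∀ ε, c ε = (1, 1) ∨ c ε = (1, 0) ∨ c ε = (0, 1) := by decide
  have hcinj : ∀ ε ε', c ε = c ε' → ε = ε' := by decide
  have hodd : ∀ x : Fin 3 × Fin n × Fin (2 * l), ¬ (Even (2 * (x.2.1 : ℤ) + (c x.1).1) ∧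
      Even (2 * (x.2.2 : ℤ) + (c x.1).2)) := fun x => by
    simp only [Int.even_iff]
    rcases hc x.1 with h | h | h <;> rw [h] <;> dsimp only <;> omega
  refine ⟨fun x => Quotient.mk _ (kagomeVertexAt
    (2 * (x.2.1 : ℤ) + (c x.1).1, 2 * (x.2.2 : ℤ) + (c x.1).2) (hodd x)), ?_, fun v => ?_⟩
  · rintro ⟨ε, ⟨a, ha⟩, ⟨b, hb⟩⟩ ⟨ε', ⟨a', ha'⟩, ⟨b', hb'⟩⟩ h
    obtain ⟨i, j, hij⟩ := mem_kagomePeriods.mp ((mk_kagomeVertexAt_eq_iff _ _).mp h)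
    obtain ⟨h1, h2⟩ := Prod.ext_iff.mp hij
    dsimp only [Prod.fst_sub, Prod.snd_sub] at h1 h2
    have e1 : 2 * (n : ℤ) * i - ((2 * l : ℕ) : ℤ) * j = 2 * (n * i - l * j) := by push_cast; ring
    have e2 : 2 * ((2 * l : ℕ) : ℤ) * j = 2 * (((2 * l : ℕ) : ℤ) * j) := by ring
    rw [e1] at h1
    rw [e2] at h2
    have hcc : c ε = c ε' := by
      rcases hc ε with h3 | h3 | h3 <;> rcases hc ε' with h4 | h4 | h4 <;>
        rw [h3, h4] at h1 h2 ⊢ <;> dsimp only at h1 h2 <;> omega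
    rw [hcc] at h1 h2
    have hb0 : (b' : ℤ) - b = 0 := by
      refine Int.eq_zero_of_abs_lt_dvd (m := ((2 * l : ℕ) : ℤ)) ⟨j, by linarith⟩ ?_
      rw [abs_lt]
      omega
    have hj : j = 0 := by
      have h3 : ((2 * l : ℕ) : ℤ) * j = 0 := by linarith
      refine (mul_eq_zero.mp h3).resolve_left ?_
      exact_mod_cast hm.ne'
    rw [hj, mul_zero, sub_zero] at h1
    have ha0 : (a' : ℤ) - a = 0 := by
      refine Int.eq_zero_of_abs_lt_dvd (m := (n : ℤ)) ⟨i, by linarith⟩ ?_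
      rw [abs_lt]
      omega
    obtain rfl : a = a' := by omega
    obtain rfl : b = b' := by omega
    rw [hcinj _ _ hcc]
  · induction v using Quotient.inductionOn with
    | h p =>
      obtain ⟨⟨x, y⟩, hd, rfl⟩ := kagomeVertexAt_surjective p
      obtain ⟨ε, x', y', hx, hy⟩ : ∃ ε x' y', x = 2 * x' + (c ε).1 ∧ y = 2 * y' + (c ε).2 := by
        simp only [Int.even_iff] at hd
        by_cases hx : x % 2 = 0
        · exact ⟨2, x / 2, y / 2, by change x = 2 * (x / 2) + 0; omega,
            by change y = 2 * (y / 2) + 1; omega⟩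
        by_cases hy : y % 2 = 0
        · exact ⟨1, x / 2, y / 2, by change x = 2 * (x / 2) + 1; omega,
            by change y = 2 * (y / 2) + 0; omega⟩
        · exact ⟨0, x / 2, y / 2, by change x = 2 * (x / 2) + 1; omega,
            by change y = 2 * (y / 2) + 1; omega⟩
      have hn0 : (n : ℤ) ≠ 0 := by exact_mod_cast hn.ne'
      have hm0 : ((2 * l : ℕ) : ℤ) ≠ 0 := by exact_mod_cast hm.ne'
      let j : ℤ := y' / ((2 * l : ℕ) : ℤ)
      obtain ⟨b, hb⟩ := Int.eq_ofNat_of_zero_le (Int.emod_nonneg y' hm0)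
      obtain ⟨a, ha⟩ := Int.eq_ofNat_of_zero_le (Int.emod_nonneg (x' + l * j) hn0)
      have hb' := Int.emod_lt_of_pos y' (by exact_mod_cast hm : (0 : ℤ) < ((2 * l : ℕ) : ℤ))
      have ha' := Int.emod_lt_of_pos (x' + l * j) (by exact_mod_cast hn : (0 : ℤ) < (n : ℤ))
      refine ⟨(ε, ⟨a, by omega⟩, ⟨b, by omega⟩), (mk_kagomeVertexAt_eq_iff _ _).mpr
        (mem_kagomePeriods.mpr ⟨(x' + l * j) / n, j, ?_⟩)⟩
      have h1 := Int.emod_add_mul_ediv (x' + l * j) n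
      have h2 := Int.emod_add_mul_ediv y' ((2 * l : ℕ) : ℤ)
      rw [ha] at h1
      rw [hb] at h2
      change (b : ℤ) + ((2 * l : ℕ) : ℤ) * j = y' at h2
      rw [hx, hy]
      push_cast at h2 ⊢
      ext
      · dsimp only [Prod.fst_sub]
        linarith
      · dsimp only [Prod.snd_sub]
        linarith

theorem kagomePeriods_finite_card {n m : ℕ} (hn : 0 < n) (hm : 0 < m) (hm2 : 2 ∣ m) :
    Finite (KagomeQuotient (kagomePeriods n m)) ∧
      Nat.card (KagomeQuotient (kagomePeriods n m)) = 3 * n * m := by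
  obtain ⟨f, hf⟩ := kagomePeriods_bijective hn hm hm2
  exact ⟨Finite.of_surjective f hf.surjective, by
    rw [← Nat.card_eq_of_bijective f hf]; simp [mul_assoc]⟩

end Kagome

theorem mainTheorem5 :
    -- the splitting for a finite non-empty graph
    (∀ (V : Type u) [Finite V] [Nonempty V] (G : SimpleGraph V) (k : ℕ)
        (M : Fin k → G.Subgraph) (σ : Fin k → Set V),
        (∀ i, (M i).IsInducedMatching) →
        (∀ i, (M i).IsDominatingTransversal (σ i)) →
        (∀ i j, i < j → (σ j \ (M i).verts).Nonempty) →
        -- each `I(M_i)` is a (non-empty) sphere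
        (∀ i, 0 < (M i).edgeSet.ncard ∧
          Nonempty ((M i).coe.indepSpace ≃ₜ UnitSphere (M i).edgeSet.ncard)) ∧
        -- if the spheres `I(M_i)` of positive dimension lie in one path component of `I(G)`
        ((∀ i j, 2 ≤ (M i).edgeSet.ncard → 2 ≤ (M j).edgeSet.ncard →
            ∀ x y : G.indepSpace, (∀ v, v ∉ (M i).verts → x.1 v = 0) →
              (∀ v, v ∉ (M j).verts → y.1 v = 0) → Joined x y) →
        ∃ (X : Type u) (_ : TopologicalSpace X) (x₀ : X),
          (∀ p : ∀ i, (M i).coe.indepSpace,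
            Nonempty (G.indepSpace ≃ₕ
              Wedge (IndexedWedge.base (fun i => (M i).coe.indepSpace) p) x₀)) ∧
          (∀ p : ∀ i, UnitSphere (M i).edgeSet.ncard,
            Nonempty (G.indepSpace ≃ₕ
              Wedge (IndexedWedge.base (fun i => UnitSphere (M i).edgeSet.ncard) p) x₀)))) ∧
    -- finite quotients of the Kagome lattice tiled by `t` large hexagons
    (∀ (L : AddSubgroup (ℤ × ℤ)) [Finite (KagomeQuotient L)], IsTiledKagome L →
        ∃ t : ℕ, 0 < t ∧ Nat.card (KagomeQuotient L) = 36 * t ∧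
          ∃ (X : Type) (_ : TopologicalSpace X) (x₀ : X),
            ∀ p : Fin (2 ^ t) → UnitSphere (8 * t),
              Nonempty ((kagomeQuotientGraph L).indepSpace ≃ₕ
                Wedge (IndexedWedge.base (fun _ : Fin (2 ^ t) => UnitSphere (8 * t)) p) x₀)) ∧
    -- the standard tori are among these quotients
    (∀ n m : ℕ, 0 < n → 0 < m → 6 ∣ n → 4 ∣ m →
        IsTiledKagome (kagomePeriods n m) ∧ Finite (KagomeQuotient (kagomePeriods n m)) ∧
          Nat.card (KagomeQuotient (kagomePeriods n m)) = 3 * n * m) := by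
  refine ⟨fun V _ _ => indepSpace_splitting, fun L _ hL =>
    kagomeQuotient_splitting (isTiledKagome_iff.mp hL), fun n m hn hm hn6 hm4 =>
    ⟨isTiledKagome_iff.mpr (kagomePeriods_le hn6 hm4),
      kagomePeriods_finite_card hn hm ((by norm_num : 2 ∣ 4).trans hm4)⟩⟩
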